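/- **Model.** $N$ asynchronous processes with identifiers $1,\dots,N$ share a non-volatile memory accessed by atomic reads and writes. At any time a system-wide crash may occur, which resets the local variables (and program counters) of all processes and preserves the non-volatile memory; an execution may contain arbitrarily many crashes. Each process $p$ has a private non-volatile structure $Ann_p$: immediately before an operation is invoked, its caller sets $Ann_p.op$ to the operation with its arguments, $Ann_p.resp:=\bot$ and $Ann_p.CP:=0$. After a crash a process that was executing an operation $Op$ (or its recovery function) executes, from the beginning and with the same arguments, the recovery function $Op.\mathrm{Recover}$ before it may invoke another operation; processes recover asynchronously, independently of each other, and recovery may itself be interrupted by crashes. $Op.\mathrm{Recover}$ returns either a response of $Op$ or the special value $\mathbf{fail}$. **Algorithm** (a read/write object with initial value $v_{init}$). Shared non-volatile variables: a register $R$ containing a triple $\langle$value, identifier of the writer, toggle index$\rangle$, initially $\langle v_{init},0,0\rangle$, where $0$ is a fictitious process that takes no steps; bits $A[i][q][b]$, initially $0$, for $1\le i\le N$, $0\le q\le N$, $b\in\{0,1\}$. Private non-volatile variables of process $p$: $RD_p$, initially $\bot$, and $T_p\in\{0,1\}$, initially $0$. $\mathrm{Write}(val)$ by $p$: 1. $\langle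 qval,q,qtoggle\rangle:=R$. 2. $A[p][q][1-qtoggle]:=0$. 3. $mtoggle:=T_p$. 4. $RD_p:=\langle mtoggle,qval,q,qtoggle\rangle$. 5. If $R\ne\langle qval,q,qtoggle\rangle$, go to 8. 6. $Ann_p.CP:=1$. 7. $R:=\langle val,p,mtoggle\rangle$. 8. $Ann_p.CP:=2$. 9. For $i=1,\dots,N$: $A[i][p][mtoggle]:=1$. 10. $T_p:=1-mtoggle$. 11. $Ann_p.resp:=\mathbf{ack}$. 12. Return $\mathbf{ack}$. $\mathrm{Write.Recover}(val)$ by $p$: $\langle mtoggle,qval,q,qtoggle\rangle:=RD_p$. If $Ann_p.resp\neq\bot$, return $\mathbf{ack}$. If $Ann_p.CP=0$, return $\mathbf{fail}$. If $Ann_p.CP=1$ and $R=\langle qval,q,qtoggle\rangle$ and $A[p][q][1-qtoggle]=0$, return $\mathbf{fail}$. Otherwise execute steps 8–12. $\mathrm{Read}$ by $p$: read $R$, write its first component $v$ to $Ann_p.resp$, return $v$. $\mathrm{Read.Recover}$: if $Ann_p.resp=\bot$, execute $\mathrm{Read}$, otherwise return $Ann_p.resp$. **Lemma.** This algorithm is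 wait-free, durably linearizable and detectable, that is: 1. (Wait-freedom.) There is a bound $B$ such that from every reachable configuration in which a process $p$ is in the midst of an operation or a recovery function, $p$ completes it within $B$ of its own steps, whatever the other processes do, provided that no crash occurs. 2. (Durable linearizability and detectability.) For every finite execution, with any number of system-wide crashes, there is a set of the operations invoked in it and a sequential order $S$ of this set, legal for a read/write object with initial value $v_{init}$, such that: every operation that completed with a response (returned by the operation itself or by its recovery function) is in $S$ with that response; no operation whose recovery function returned $\mathbf{fail}$ is in $S$; and if an operation completed with a response before another operation was invoked (even if crashes occurred in between), then the former does not come after the latter in $S$. Operations that have neither returned a response nor $\mathbf{fail}$ may or may not be in $S$. -/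

import Mathlib

/-! ### Histories of a crash-recovery object, durable linearizability and detectability -/

namespace CrashRecovery

/-- Events of a history: `inv p o` is the invocation of operation `o` by process `p`; `ret p r` says
that the pending operation of `p` completes with response `r`, returned by the operation itself or by
its recovery function; `fail p` says that the recovery function of the pending operation of `p`
returns the special value **fail**; `crash` is a system-wide crash-failure. -/
inductive Event (P Op Resp : Type*)
  | inv (p : P) (o : Op)
  | ret (p : P) (r : Resp)
  | fail (p : P)
  | crash

variable {P Op Resp σ : Type*}

/-- `e` ends the pending operation of process `p`. -/
def Event.EndsOp (p : P) (e : Event P Op Resp) : Prop :=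
  (∃ r, e = .ret p r) ∨ e = .fail p

/-- In the history `h`, the operation invoked at position `i` is ended by the event `e`, which is
at position `j`. An operation instance is identified with the position of its invocation. -/
def EndsWith (h : List (Event P Op Resp)) (i j : ℕ) (e : Event P Op Resp) : Prop :=
  ∃ p o, h[i]? = some (.inv p o) ∧ i < j ∧ h[j]? = some e ∧ e.EndsOp p ∧
    ∀ k, i < k → k < j → ∀ e', h[k]? = some e' → ¬ e'.EndsOp p

/-- The operation invoked at position `i` completes at position `j` with response `r`. -/
def CompletesAt (h : List (Event P Op Resp)) (i j : ℕ) (r : Resp) : Prop :=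
  ∃ p, EndsWith h i j (.ret p r)

/-- The recovery function of the operation invoked at position `i` returns **fail** at
position `j`. -/
def FailsAt (h : List (Event P Op Resp)) (i j : ℕ) : Prop :=
  ∃ p, EndsWith h i j (.fail p)

/-- A sequence of operations and responses is legal for the sequential object `δ` started in
state `s`. -/
def Legal (δ : σ → Op → σ × Resp) : σ → List (Op × Resp) → Prop
  | _, [] => True
  | s, (o, r) :: l => r = (δ s o).2 ∧ Legal δ (δ s o).1 l

/-- `S` is a durable linearization of the history `h`. An entry `(i, o, r)` of `S` stands for the
operation `o` invoked at position `i` of `h`, with response `r`. Crash events are ignored: operations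
may stay pending over any number of crashes, and the real-time order extends over crashes. -/
structure IsDurableLinearization (δ : σ → Op → σ × Resp) (s₀ : σ)
    (h : List (Event P Op Resp)) (S : List (ℕ × Op × Resp)) : Prop where
  /-- `S` consists of operations invoked in `h` ... -/
  invoked : ∀ x ∈ S, ∃ p, h[x.1]? = some (.inv p x.2.1)
  /-- ... each of them taking effect at most once. -/
  nodup : (S.map (fun x => x.1)).Nodup
  /-- Every completed operation is in `S`, with the response that it returned. -/
  complete : ∀ i j r, CompletesAt h i j r → ∃ o, (i, o, r) ∈ S
  /-- If `x` is before `y` in `S`, then `y` did not complete before `x` was invoked. -/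
  realTime : S.Pairwise (fun x y => ∀ j r, CompletesAt h y.1 j r → ¬ j < x.1)
  /-- `S` is a sequential execution of the object. -/
  legal : Legal δ s₀ (S.map (fun x => x.2))

/-- The answers given to the callers in `h` tell correctly which operations are linearized in `S`:
**fail** means that the operation is not linearized (neither before nor after this answer), and a
response `r` means that it is linearized with response `r`. -/
structure IsDetectable (h : List (Event P Op Resp)) (S : List (ℕ × Op × Resp)) : Prop where
  fail : ∀ i j, FailsAt h i j → ∀ x ∈ S, x.1 ≠ i
  response : ∀ i j r, CompletesAt h i j r → ∃ o, (i, o, r) ∈ S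

end CrashRecovery

/-! ### The bounded-space detectable read/write object -/

namespace DetectableRW

open CrashRecovery

/-- Operations of a read/write object with values in `V`. -/
inductive Op (V : Type*)
  | read
  | write (val : V)

/-- Responses of a read/write object. -/
inductive Resp (V : Type*)
  | ack
  | value (v : V)

/-- Sequential specification of the read/write object. -/
def spec {V : Type*} : V → Op V → V × Resp V
  | s, .read => (s, .value s)
  | _, .write v => (v, .ack)

/-- Process identifiers as they are stored in `R`: the `N` processes have identifiers `1, …, N`;
`0` is the fictitious process to which the initial value is attributed. -/
abbrev Ident (N : ℕ) := Fin (N + 1)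

/-- The identifier of a process. -/
abbrev ident {N : ℕ} (p : Fin N) : Ident N := p.succ

/-- Contents `⟨v, q, b⟩` of `R`: value, identifier of the writer, and index of its toggle-bit array.
Bits and indices in `{0, 1}` are Booleans, with `0 = false`; so `1 - b` is `!b`. -/
abbrev Triple (N : ℕ) (V : Type*) := V × Ident N × Bool

/-- The non-volatile memory. -/
structure Memory (N : ℕ) (V : Type*) where
  /-- the shared register `R` -/
  R : Triple N V
  /-- the shared bits: `A i q b` is the bit for process `i` of the toggle-bit array `b` of `q` -/
  A : Fin N → Ident N → Bool → Bool
  /-- private `RD_p`, containing `⊥` or `⟨mtoggle, ⟨qval, q, qtoggle⟩⟩` -/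
  RD : Fin N → Option (Bool × Triple N V)
  /-- private `T_p` -/
  T : Fin N → Bool
  /-- `Ann_p.op`: the operation that `p` is currently performing, with its argument -/
  annOp : Fin N → Option (Op V)
  /-- `Ann_p.resp` -/
  annResp : Fin N → Option (Resp V)
  /-- `Ann_p.CP` -/
  annCP : Fin N → Fin 3

/-- The volatile state of a process: its program counter and the local variables that are still
in use. Each constructor is named after the instruction to be executed next. -/
inductive Local (N : ℕ) (V : Type*)
  /-- initial local state: no code is being executed -/
  | idle
  /-- `⟨qval, q, qtoggle⟩ := R` (start of `Write(val)`) -/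
  | wReadR (val : V)
  /-- `A[p][q][1 - qtoggle] := 0` -/
  | wResetBit (val : V) (t : Triple N V)
  /-- `mtoggle := T_p` -/
  | wReadT (val : V) (t : Triple N V)
  /-- `RD_p := ⟨mtoggle, qval, q, qtoggle⟩` -/
  | wPersist (val : V) (t : Triple N V) (mtoggle : Bool)
  /-- `if R ≠ ⟨qval, q, qtoggle⟩ then goto (Ann_p.CP := 2)` -/
  | wRereadR (val : V) (t : Triple N V) (mtoggle : Bool)
  /-- `Ann_p.CP := 1` -/
  | wSetCP1 (val : V) (mtoggle : Bool)
  /-- `R := ⟨val, p, mtoggle⟩` -/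
  | wWriteR (val : V) (mtoggle : Bool)
  /-- `Ann_p.CP := 2`; this and the next three instructions are common to `Write` and
  `Write.Recover` -/
  | setCP2 (mtoggle : Bool)
  /-- the `for` loop `A[i][p][mtoggle] := 1`; `i` is the number of iterations already performed -/
  | setBits (mtoggle : Bool) (i : ℕ)
  /-- `T_p := 1 - mtoggle` -/
  | flipT (mtoggle : Bool)
  /-- `Ann_p.resp := ack` -/
  | setAck
  /-- `⟨mtoggle, qval, q, qtoggle⟩ := RD_p` (start of `Write.Recover`) -/
  | recReadRD
  /-- `if Ann_p.resp ≠ ⊥ then return ack` -/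
  | recCheckResp (rd : Option (Bool × Triple N V))
  /-- `if Ann_p.CP = 0 then return fail` -/
  | recCheckCP0 (rd : Option (Bool × Triple N V))
  /-- `if Ann_p.CP = 1 then ...` -/
  | recCheckCP1 (rd : Option (Bool × Triple N V))
  /-- first condition of the inner `if`: `R = ⟨qval, q, qtoggle⟩` -/
  | recCheckR (mtoggle : Bool) (t : Triple N V)
  /-- second condition of the inner `if`: `A[p][q][1 - qtoggle] = 0` -/
  | recCheckBit (mtoggle : Bool) (t : Triple N V)
  /-- read `R` and extract its first component (start of `Read`) -/
  | rReadR
  /-- `Ann_p.resp := v` -/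
  | rPersist (v : V)
  /-- `if Ann_p.resp = ⊥ then` re-invoke `Read` `else return Ann_p.resp`
  (start of `Read.Recover`) -/
  | rRecCheckResp
  /-- `return r` -/
  | retResp (r : Resp V)
  /-- `return fail` -/
  | retFail

variable {N : ℕ} {V : Type*}

/-- First instruction of an operation. -/
def entry : Op V → Local N V
  | .read => .rReadR
  | .write v => .wReadR v

/-- First instruction of the recovery function of an operation. -/
def recEntry : Op V → Local N V
  | .read => .rRecCheckResp
  | .write _ => .recReadRD

/-- The instructions of process `p` other than the `return` instructions:
`Instr p m l m' l'` says that `p`, in local state `l` and with non-volatile memory `m`, can execute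
one instruction (with at most one access to the non-volatile memory), leading to `m'` and `l'`. -/
inductive Instr (p : Fin N) : Memory N V → Local N V → Memory N V → Local N V → Prop
  -- Write
  | wReadR (m val) : Instr p m (.wReadR val) m (.wResetBit val m.R)
  | wResetBit (m val qval q qtoggle) :
      Instr p m (.wResetBit val (qval, q, qtoggle))
        { m with A := fun i j b => if i = p ∧ j = q ∧ b = !qtoggle then false else m.A i j b }
        (.wReadT val (qval, q, qtoggle))
  | wReadT (m val t) : Instr p m (.wReadT val t) m (.wPersist val t (m.T p))
  | wPersist (m val t mtoggle) :
      Instr p m (.wPersist val t mtoggle)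
        { m with RD := Function.update m.RD p (some (mtoggle, t)) } (.wRereadR val t mtoggle)
  | wRereadR_ne (m val t mtoggle) (h : m.R ≠ t) :
      Instr p m (.wRereadR val t mtoggle) m (.setCP2 mtoggle)
  | wRereadR_eq (m val t mtoggle) (h : m.R = t) :
      Instr p m (.wRereadR val t mtoggle) m (.wSetCP1 val mtoggle)
  | wSetCP1 (m val mtoggle) :
      Instr p m (.wSetCP1 val mtoggle)
        { m with annCP := Function.update m.annCP p 1 } (.wWriteR val mtoggle)
  | wWriteR (m val mtoggle) :
      Instr p m (.wWriteR val mtoggle)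
        { m with R := (val, ident p, mtoggle) } (.setCP2 mtoggle)
  -- the common last part of Write and Write.Recover
  | setCP2 (m mtoggle) :
      Instr p m (.setCP2 mtoggle)
        { m with annCP := Function.update m.annCP p 2 } (.setBits mtoggle 0)
  | setBits (m mtoggle) (i : Fin N) :
      Instr p m (.setBits mtoggle i.val)
        { m with A := fun k j b =>
            if k = i ∧ j = ident p ∧ b = mtoggle then true else m.A k j b }
        (.setBits mtoggle (i.val + 1))
  | setBits_end (m mtoggle) : Instr p m (.setBits mtoggle N) m (.flipT mtoggle)
  | flipT (m mtoggle) :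
      Instr p m (.flipT mtoggle) { m with T := Function.update m.T p (!mtoggle) } .setAck
  | setAck (m) :
      Instr p m .setAck
        { m with annResp := Function.update m.annResp p (some .ack) } (.retResp .ack)
  -- Write.Recover
  | recReadRD (m) : Instr p m .recReadRD m (.recCheckResp (m.RD p))
  | recCheckResp_set (m rd) (h : m.annResp p ≠ none) :
      Instr p m (.recCheckResp rd) m (.retResp .ack)
  | recCheckResp_bot (m rd) (h : m.annResp p = none) :
      Instr p m (.recCheckResp rd) m (.recCheckCP0 rd)
  | recCheckCP0_eq (m rd) (h : m.annCP p = 0) : Instr p m (.recCheckCP0 rd) m .retFail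
  | recCheckCP0_ne (m rd) (h : m.annCP p ≠ 0) : Instr p m (.recCheckCP0 rd) m (.recCheckCP1 rd)
  | recCheckCP1_eq (m mtoggle t) (h : m.annCP p = 1) :
      Instr p m (.recCheckCP1 (some (mtoggle, t))) m (.recCheckR mtoggle t)
  | recCheckCP1_ne (m mtoggle t) (h : m.annCP p ≠ 1) :
      Instr p m (.recCheckCP1 (some (mtoggle, t))) m (.setCP2 mtoggle)
  | recCheckR_eq (m mtoggle t) (h : m.R = t) :
      Instr p m (.recCheckR mtoggle t) m (.recCheckBit mtoggle t)
  | recCheckR_ne (m mtoggle t) (h : m.R ≠ t) :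
      Instr p m (.recCheckR mtoggle t) m (.setCP2 mtoggle)
  | recCheckBit_zero (m mtoggle qval q qtoggle) (h : m.A p q (!qtoggle) = false) :
      Instr p m (.recCheckBit mtoggle (qval, q, qtoggle)) m .retFail
  | recCheckBit_one (m mtoggle qval q qtoggle) (h : m.A p q (!qtoggle) = true) :
      Instr p m (.recCheckBit mtoggle (qval, q, qtoggle)) m (.setCP2 mtoggle)
  -- Read
  | rReadR (m) : Instr p m .rReadR m (.rPersist m.R.1)
  | rPersist (m v) :
      Instr p m (.rPersist v)
        { m with annResp := Function.update m.annResp p (some (.value v)) } (.retResp (.value v))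
  -- Read.Recover
  | rRecCheckResp_bot (m) (h : m.annResp p = none) : Instr p m .rRecCheckResp m .rReadR
  | rRecCheckResp_set (m r) (h : m.annResp p = some r) : Instr p m .rRecCheckResp m (.retResp r)

/-- A configuration: the non-volatile memory and the local states of the processes. -/
structure Config (N : ℕ) (V : Type*) where
  mem : Memory N V
  loc : Fin N → Local N V

/-- The initial configuration. -/
def init (N : ℕ) {V : Type*} (vinit : V) : Config N V where
  mem :=
    { R := (vinit, 0, false)
      A := fun _ _ _ => false
      RD := fun _ => none
      T := fun _ => false
      annOp := fun _ => none
      annResp := fun _ => none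
      annCP := fun _ => 0 }
  loc := fun _ => .idle

/-- The actions by which an execution proceeds. -/
inductive Action (N : ℕ) (V : Type*)
  /-- the caller announces an operation and invokes it -/
  | invoke (p : Fin N) (o : Op V)
  /-- after a crash, `p` starts the recovery function of the operation it was executing -/
  | recover (p : Fin N)
  /-- `p` executes an instruction other than `return` -/
  | step (p : Fin N)
  /-- `p` returns a response -/
  | ret (p : Fin N) (r : Resp V)
  /-- `p` returns **fail** -/
  | fail (p : Fin N)
  /-- a system-wide crash-failure -/
  | crash

/-- One transition of the system. Invocations are made by idle processes only; a process that was
executing an operation when a crash occurred has to complete the recovery function of that operation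
(which it may have to start several times, if there are further crashes) before it is idle again.
A crash resets all local states and preserves the non-volatile memory. -/
inductive Step : Config N V → Action N V → Config N V → Prop
  | invoke (c : Config N V) (p : Fin N) (o : Op V)
      (hl : c.loc p = .idle) (ha : c.mem.annOp p = none) :
      Step c (.invoke p o)
        { mem := { c.mem with
            annOp := Function.update c.mem.annOp p (some o)
            annResp := Function.update c.mem.annResp p none
            annCP := Function.update c.mem.annCP p 0 }
          loc := Function.update c.loc p (entry o) }
  | recover (c : Config N V) (p : Fin N) (o : Op V)
      (hl : c.loc p = .idle) (ha : c.mem.annOp p = some o) :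
      Step c (.recover p) { c with loc := Function.update c.loc p (recEntry o) }
  | step (c : Config N V) (p : Fin N) (m' : Memory N V) (l' : Local N V)
      (h : Instr p c.mem (c.loc p) m' l') :
      Step c (.step p) { mem := m', loc := Function.update c.loc p l' }
  | ret (c : Config N V) (p : Fin N) (r : Resp V) (hl : c.loc p = .retResp r) :
      Step c (.ret p r)
        { mem := { c.mem with annOp := Function.update c.mem.annOp p none }
          loc := Function.update c.loc p .idle }
  | fail (c : Config N V) (p : Fin N) (hl : c.loc p = .retFail) :
      Step c (.fail p)
        { mem := { c.mem with annOp := Function.update c.mem.annOp p none }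
          loc := Function.update c.loc p .idle }
  | crash (c : Config N V) : Step c .crash { c with loc := fun _ => .idle }

/-- `Exec c tr c'`: the sequence `tr` of actions is an execution leading from `c` to `c'`. -/
inductive Exec : Config N V → List (Action N V) → Config N V → Prop
  | nil (c : Config N V) : Exec c [] c
  | snoc {c c' c'' : Config N V} {tr : List (Action N V)} {a : Action N V} :
      Exec c tr c' → Step c' a c'' → Exec c (tr ++ [a]) c''

/-- The event of the history to which an action gives rise. -/
def Action.event : Action N V → Option (Event (Fin N) (Op V) (Resp V))
  | .invoke p o => some (.inv p o)
  | .recover _ => none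
  | .step _ => none
  | .ret p r => some (.ret p r)
  | .fail p => some (.fail p)
  | .crash => some .crash

/-- The history of an execution. -/
def history (tr : List (Action N V)) : List (Event (Fin N) (Op V) (Resp V)) :=
  tr.filterMap Action.event

/-- Configurations reachable from the initial one, by an execution with any number of crashes. -/
def Reachable (vinit : V) (c : Config N V) : Prop :=
  ∃ tr, Exec (init N vinit) tr c

/-- The action is the execution of a `return` instruction by `p`. -/
def Action.IsReturnOf (p : Fin N) (a : Action N V) : Prop :=
  (∃ r, a = .ret p r) ∨ a = .fail p

/-- The action is the execution of an instruction by `p`. -/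
def Action.IsInstrOf (p : Fin N) (a : Action N V) : Prop :=
  a = .step p ∨ a.IsReturnOf p

open Classical in
/-- The number of instructions of `p` in an execution. -/
noncomputable def numInstr (p : Fin N) (tr : List (Action N V)) : ℕ :=
  tr.countP (fun a => decide (a.IsInstrOf p))

/-- Wait-freedom, with a bound that is uniform over all executions: for every reachable configuration
in which `p` is in the midst of an operation or of a recovery function, whatever the other processes
do, as long as there is no crash and `p` has not returned, `p` can execute a further instruction,
but has executed at most `B` of them. So `p` returns within `B + 1` of its own steps.
Moreover, a process that has to recover can start its recovery function at any time. -/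
def WaitFree (N : ℕ) {V : Type*} (vinit : V) : Prop :=
  (∃ B : ℕ, ∀ (c : Config N V) (p : Fin N), Reachable vinit c → c.loc p ≠ .idle →
    ∀ (tr : List (Action N V)) (c' : Config N V), Exec c tr c' →
      (∀ a ∈ tr, a ≠ .crash ∧ ¬ a.IsReturnOf p) →
        numInstr p tr ≤ B ∧ ∃ a c'', a.IsInstrOf p ∧ Step c' a c'') ∧
  ∀ (c : Config N V) (p : Fin N), Reachable vinit c → c.loc p = .idle → c.mem.annOp p ≠ none →
    ∃ c', Step c (.recover p) c'

end DetectableRW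

/-!
The proof runs the algorithm together with a ghost state, which counts the writes to `R`. The number
of writes performed so far is the current *version*, and every operation is linearized at a version
that is current at some time during the operation, in one of three ways (`Kind`): a write that
reaches `R` creates a version; a read returns the content of a version; a write whose process has
found, possibly during recovery, that `R` has changed since its invocation is placed at the end of
the version at its invocation, just before the write that creates the next version, so that no read
can observe it. Such a write is linearized when `CP` is set to `2`, for only from then on is its
recovery bound to return a response.

Listing the versions in order, and within each version first the write that creates it, then the
reads, then the overwritten writes, each group in the order of invocation, gives a legal sequential
execution (`Hist.legal_order`) that respects the real-time order (`Hist.not_completes_before`): if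
`y` completed before `x` was invoked, then the version at the end of `y` is at most the version at
the invocation of `x`, which leaves no way for `x` to be listed before `y`.

The heart of the matter is that `Write.Recover` with `CP = 1` answers correctly, although `R` may
contain again the triple `(v, q, b)` that was read before `R` was written: the ABA problem.
Suppose that `p` has read this triple, has reset the bit `A p q (!b)`, and has found `R` unchanged.
* If `p` has then written `R`, and `R` contains `(v, q, b)` again, then `q` has completed in between
  a write with toggle index `!b`, since `q` flips its toggle index with each write that takes effect.
  That write has set the bit `A p q (!b)`, and only `p` could have reset it (`BitComplete`).
* Conversely, if the bit `A p q (!b)` is set, then the write of `q` that has set it was invoked after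
  `(v, q, b)` was written, and it sets bits only after `R` has been written since its own invocation.
  So `R` has been written since the invocation of the operation of `p` (`BitSound`), and this
  operation can be linearized as an overwritten one.

These two facts are part of an invariant `Inv` of configurations and ghost states. The invariant of a
process mentions other processes only through `R`, its own row of `A`, and the stage that the last
writer has reached; `ActsAs` describes what a single action of another process can do to these, and
`ActsAs.inv` reduces the preservation of the invariant to the process that acts. `GStep` extracts
what each action does to the ghost state, and `Hist` links this to the history.
Wait-freedom holds because every instruction decreases `Local.rank`.
-/

namespace DetectableRW

open CrashRecovery

variable {N : ℕ} {V : Type*}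

/-! ### Ghost state and invariant -/

/-- The three ways in which an operation is linearized relative to the sequence of versions of `R`:
as the write that creates a version, as a read of a version, or as a write that is overwritten
immediately, by the write that creates the next version. -/
inductive Kind
  | write
  | read
  | skip

/-- Ghost state of an execution. A *version* is the number of writes to `R` performed so far. -/
structure Ghost (N : ℕ) (V : Type*) where
  /-- the current version -/
  ver : ℕ
  /-- the content of `R` at each version up to the current one -/
  cont : ℕ → Triple N V
  /-- how, and at which version, the last operation of each process has been linearized -/
  lin : Fin N → Option (Kind × ℕ)
  /-- the version at which the last operation of each process was invoked -/
  start : Fin N → ℕ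
  /-- the value of `T_p` when the last operation of `p` was invoked -/
  tog : Fin N → Bool
  /-- the version at which `p` last found `R` unchanged when reading it again -/
  seen : Fin N → ℕ

/-- A process in this local state is not in the part of a write between setting the bit of process
`p` and flipping its toggle index. (Once the index has been flipped, its value tells so.) -/
def NotPast (p : Fin N) : Local N V → Prop
  | .setBits _ j => j ≤ p.val
  | .flipT _ => False
  | _ => True

/-- Process `q`, the writer of version `s` of `R` with toggle index `b`, has not set the bit of
process `p` with the opposite index since: either the write of version `s` is still the last
operation of `q`, or the last operation of `q` works with the opposite index, has not flipped
`T_q`, and, unless a crash has sent it back, has not passed the bit of `p`. -/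
def Own (g : Ghost N V) (c : Config N V) (q : Fin N) (s : ℕ) (b : Bool) (p : Fin N) : Prop :=
  (g.lin q = some (.write, s) ∧ g.tog q = b) ∨
    (s ≤ g.start q ∧ g.tog q = !b ∧ c.mem.T q = g.tog q ∧ NotPast p (c.loc q))

/-- `R` contained `t` at some time during the current operation of `p`. -/
def Fresh (g : Ghost N V) (p : Fin N) (t : Triple N V) : Prop :=
  ∃ k, g.start p ≤ k ∧ k ≤ g.ver ∧ g.cont k = t

/-- If the bit that `p` reset after reading `t` is set again, then `R` has been written since the
invocation of the current operation of `p`. -/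
def BitSound (g : Ghost N V) (c : Config N V) (p : Fin N) (t : Triple N V) : Prop :=
  c.mem.A p t.2.1 (!t.2.2) = true → g.start p < g.ver

/-- Unless the bit that `p` reset after reading `t` is set again, the writer of `t` has not written
with the same toggle index since `p` found `R` unchanged, and it is not about to do so. -/
def BitComplete (g : Ghost N V) (c : Config N V) (p : Fin N) (t : Triple N V) : Prop :=
  c.mem.A p t.2.1 (!t.2.2) = true ∨
    ((∀ k, g.seen p < k → k ≤ g.ver →
        ¬ ((g.cont k).2.1 = t.2.1 ∧ (g.cont k).2.2 = t.2.2)) ∧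
      ∀ q, t.2.1 = ident q → Own g c q (g.seen p) t.2.2 p)

/-- What is known about the triple `t` in `RD_p` once `p` has found `R` unchanged. -/
def Claim (g : Ghost N V) (c : Config N V) (p : Fin N) (t : Triple N V) : Prop :=
  Fresh g p t ∧ BitSound g c p t ∧ BitComplete g c p t

/-- The part of the invariant of a pending write of `p` that concerns the non-volatile memory, and
hence survives a crash; one alternative for each value of `Ann_p.CP`. -/
def WriteMem (g : Ghost N V) (c : Config N V) (p : Fin N) : Prop :=
  (c.mem.annCP p = 0 ∧ c.mem.annResp p = none ∧ g.lin p = none ∧ c.mem.T p = g.tog p) ∨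
  (c.mem.annCP p = 1 ∧ c.mem.annResp p = none ∧ c.mem.T p = g.tog p ∧
    (g.lin p = none ∨ (∃ k, g.lin p = some (.write, k)) ∧ g.seen p < g.ver) ∧
    ∃ t, c.mem.RD p = some (g.tog p, t) ∧ Claim g c p t) ∨
  (c.mem.annCP p = 2 ∧ (∃ kd k, g.lin p = some (kd, k) ∧ kd ≠ .read) ∧ g.start p < g.ver ∧
    (∃ t, c.mem.RD p = some (g.tog p, t)) ∧
    (c.mem.annResp p = none ∨ c.mem.annResp p = some .ack ∧ c.mem.T p = !g.tog p))

/-- The part of the invariant of a pending `Write(val)` of `p` that concerns its local state. -/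
def WriteLoc (g : Ghost N V) (c : Config N V) (p : Fin N) (val : V) : Local N V → Prop
  | .idle => True
  | .wReadR v => v = val ∧ c.mem.annCP p = 0
  | .wResetBit v t => v = val ∧ c.mem.annCP p = 0 ∧ Fresh g p t
  | .wReadT v t => v = val ∧ c.mem.annCP p = 0 ∧ Fresh g p t ∧ BitSound g c p t
  | .wPersist v t b => v = val ∧ c.mem.annCP p = 0 ∧ Fresh g p t ∧ BitSound g c p t ∧ b = g.tog p
  | .wRereadR v t b => v = val ∧ c.mem.annCP p = 0 ∧ Fresh g p t ∧ BitSound g c p t ∧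
      b = g.tog p ∧ c.mem.RD p = some (b, t)
  | .wSetCP1 v b => v = val ∧ c.mem.annCP p = 0 ∧ b = g.tog p ∧
      ∃ t, c.mem.RD p = some (b, t) ∧ Claim g c p t
  | .wWriteR v b => v = val ∧ c.mem.annCP p = 1 ∧ b = g.tog p ∧ g.lin p = none
  | .setCP2 b => b = g.tog p ∧ g.start p < g.ver ∧ c.mem.annResp p = none ∧
      ∃ t, c.mem.RD p = some (b, t)
  | .setBits b i => b = g.tog p ∧ i ≤ N ∧ c.mem.annCP p = 2 ∧ c.mem.annResp p = none
  | .flipT b => b = g.tog p ∧ c.mem.annCP p = 2 ∧ c.mem.annResp p = none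
  | .setAck => c.mem.annCP p = 2 ∧ c.mem.annResp p = none ∧ c.mem.T p = !g.tog p
  | .recReadRD => True
  | .recCheckResp rd => rd = c.mem.RD p
  | .recCheckCP0 rd => rd = c.mem.RD p ∧ c.mem.annResp p = none
  | .recCheckCP1 rd => rd = c.mem.RD p ∧ c.mem.annResp p = none ∧ c.mem.annCP p ≠ 0
  | .recCheckR b t => c.mem.RD p = some (b, t) ∧ c.mem.annCP p = 1
  | .recCheckBit b t => c.mem.RD p = some (b, t) ∧ c.mem.annCP p = 1 ∧
      (g.lin p = none ∨ c.mem.A p t.2.1 (!t.2.2) = true)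
  | .retResp r => r = .ack ∧ c.mem.annResp p ≠ none
  | .retFail => g.lin p = none
  | _ => False

/-- The part of the invariant of a pending read of `p` that concerns the non-volatile memory. -/
def ReadMem (g : Ghost N V) (c : Config N V) (p : Fin N) : Prop :=
  c.mem.T p = g.tog p ∧
    ((c.mem.annResp p = none ∧ g.lin p = none) ∨
      ∃ k, k ≤ g.ver ∧ c.mem.annResp p = some (.value (g.cont k).1) ∧ g.lin p = some (.read, k))

/-- The part of the invariant of a pending read of `p` that concerns its local state. -/
def ReadLoc (g : Ghost N V) (c : Config N V) (p : Fin N) : Local N V → Prop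
  | .idle => True
  | .rReadR => c.mem.annResp p = none
  | .rPersist v => c.mem.annResp p = none ∧ ∃ k, g.start p ≤ k ∧ k ≤ g.ver ∧ (g.cont k).1 = v
  | .rRecCheckResp => True
  | .retResp r => c.mem.annResp p = some r
  | _ => False

/-- The value of `T_p` after an operation that started with `T_p = b` and was linearized as
indicated: it is flipped by the writes that take effect. -/
def settledTog : Option (Kind × ℕ) → Bool → Bool
  | some (.write, _), b => !b
  | some (.skip, _), b => !b
  | _, b => b

/-- The invariant of process `p`. -/
def ProcInv (g : Ghost N V) (c : Config N V) (p : Fin N) : Prop :=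
  match c.mem.annOp p with
  | none => c.loc p = .idle ∧ c.mem.T p = settledTog (g.lin p) (g.tog p)
  | some .read => ReadMem g c p ∧ ReadLoc g c p (c.loc p)
  | some (.write v) => WriteMem g c p ∧ WriteLoc g c p v (c.loc p)

/-- The current content `(v, q, b)` of `R` was either written by the last operation of `q`, or the
last operation of `q` was invoked afterwards, works with the other toggle index, and has not
flipped `T_q`. -/
def Owner (g : Ghost N V) (c : Config N V) (q : Fin N) : Prop :=
  ∀ v b, c.mem.R = (v, ident q, b) →
    (g.lin q = some (.write, g.ver) ∧ g.tog q = b) ∨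
      (g.ver ≤ g.start q ∧ g.tog q = !b ∧ c.mem.T q = g.tog q)

/-- The invariant of the algorithm. -/
structure Inv (g : Ghost N V) (c : Config N V) : Prop where
  reg : c.mem.R = g.cont g.ver
  start_le : ∀ p, g.start p ≤ g.ver
  seen_le : ∀ p, g.seen p ≤ g.ver
  owner : ∀ q, Owner g c q
  proc : ∀ p, ProcInv g c p

theorem inv_init (N : ℕ) (vinit : V) :
    Inv ⟨0, fun _ => (vinit, 0, false), fun _ => none, fun _ => 0, fun _ => false, fun _ => 0⟩
      (init N vinit) where
  reg := rfl
  start_le _ := le_rfl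
  seen_le _ := le_rfl
  owner q v b h := by
    simp only [init, Prod.mk.injEq] at h
    exact absurd h.2.1.symm (Fin.succ_ne_zero q)
  proc p := by simp [ProcInv, init, settledTog]

/-! ### Stability of the invariant under the actions of other processes -/

/-- The action leading from `(g, c)` to `(g', c')` is an action of process `p`: it changes only the
parts of the configuration and of the ghost state that `p` may change, and sets bits and writes to
`R` only in the way a write of `p` does. -/
structure ActsAs (p : Fin N) (g : Ghost N V) (c : Config N V) (g' : Ghost N V) (c' : Config N V) :
    Prop where
  loc : ∀ q, q ≠ p → c'.loc q = c.loc q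
  T : ∀ q, q ≠ p → c'.mem.T q = c.mem.T q
  RD : ∀ q, q ≠ p → c'.mem.RD q = c.mem.RD q
  annOp : ∀ q, q ≠ p → c'.mem.annOp q = c.mem.annOp q
  annResp : ∀ q, q ≠ p → c'.mem.annResp q = c.mem.annResp q
  annCP : ∀ q, q ≠ p → c'.mem.annCP q = c.mem.annCP q
  lin : ∀ q, q ≠ p → g'.lin q = g.lin q
  start : ∀ q, q ≠ p → g'.start q = g.start q
  tog : ∀ q, q ≠ p → g'.tog q = g.tog q
  seen : ∀ q, q ≠ p → g'.seen q = g.seen q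
  ver_le : g.ver ≤ g'.ver
  cont : ∀ k, k ≤ g.ver → g'.cont k = g.cont k
  cont_new : ∀ k, g.ver < k → k ≤ g'.ver →
    (g'.cont k).2.1 = ident p ∧ (g'.cont k).2.2 = g.tog p ∧ g.lin p = none
  bit_mono : ∀ q, q ≠ p → ∀ j b, c.mem.A q j b = true → c'.mem.A q j b = true
  bit_new : ∀ q j b, c'.mem.A q j b = true →
    c.mem.A q j b = true ∨ (j = ident p ∧ b = g.tog p ∧ g.start p < g.ver)
  own : ∀ q s b, s ≤ g.ver → Own g c p s b q →
    c'.mem.A q (ident p) (!b) = true ∨ Own g' c' p s b q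

section

variable {p q : Fin N} {g g' : Ghost N V} {c c' : Config N V} {t : Triple N V}

theorem ActsAs.fresh (D : ActsAs p g c g' c') (hs : g'.start q = g.start q) (h : Fresh g q t) :
    Fresh g' q t := by
  obtain ⟨k, h1, h2, h3⟩ := h
  exact ⟨k, hs ▸ h1, h2.trans D.ver_le, (D.cont k h2).trans h3⟩

/-- A bit of `q` can be set by an operation of the writer of `t` with the other toggle index only
after the invocation of that operation, and after a write to `R` that follows this invocation. -/
theorem ActsAs.bitSound (D : ActsAs p g c g' c') (hI : Inv g c) (hs : g'.start q = g.start q)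
    (hf : Fresh g q t) (h : BitSound g c q t) : BitSound g' c' q t := by
  intro hA
  rw [hs]
  refine lt_of_lt_of_le ?_ D.ver_le
  rcases D.bit_new _ _ _ hA with hA | ⟨h1, h2, h3⟩
  · exact h hA
  · by_contra hlt
    obtain ⟨k, hk1, hk2, hk3⟩ := hf
    obtain rfl : k = g.ver := by omega
    obtain ⟨v, j, b⟩ := t
    have hR := hI.reg.trans hk3
    simp only at h1 h2
    subst h1
    rcases hI.owner p v b hR with ⟨-, h4⟩ | ⟨h4, -⟩
    · rw [h4] at h2; simp at h2
    · omega

theorem ActsAs.bitComplete (D : ActsAs p g c g' c') (hI : Inv g c) (hs : g'.seen q = g.seen q)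
    (hA : ∀ j b, c.mem.A q j b = true → c'.mem.A q j b = true) (h : BitComplete g c q t) :
    BitComplete g' c' q t := by
  rcases h with h | ⟨h1, h2⟩
  · exact .inl (hA _ _ h)
  by_cases hb : c'.mem.A q t.2.1 (!t.2.2) = true
  · exact .inl hb
  refine .inr ⟨fun k hk hk' => ?_, fun r hr => ?_⟩
  · rw [hs] at hk
    by_cases hkv : k ≤ g.ver
    · rw [D.cont k hkv]; exact h1 k hk hkv
    · obtain ⟨h3, h4, h5⟩ := D.cont_new k (by omega) hk'
      rintro ⟨h6, h7⟩
      rcases h2 p (h6.symm.trans h3) with ⟨hj, -⟩ | ⟨-, h8, -⟩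
      · simp [h5] at hj
      · rw [← h4, h7] at h8; simp at h8
  · rw [hs]
    have h3 := h2 r hr
    by_cases hrp : r = p
    · subst hrp
      refine (D.own q _ _ (hI.seen_le q) h3).resolve_left ?_
      rwa [hr] at hb
    · unfold Own at h3 ⊢
      rwa [D.lin r hrp, D.tog r hrp, D.start r hrp, D.T r hrp, D.loc r hrp]

theorem ActsAs.claim (D : ActsAs p g c g' c') (hI : Inv g c) (hs : g'.start q = g.start q)
    (hs' : g'.seen q = g.seen q) (hA : ∀ j b, c.mem.A q j b = true → c'.mem.A q j b = true)
    (h : Claim g c q t) : Claim g' c' q t :=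
  ⟨D.fresh hs h.1, D.bitSound hI hs h.1 h.2.1, D.bitComplete hI hs' hA h.2.2⟩

theorem ActsAs.procInv (D : ActsAs p g c g' c') (hI : Inv g c) (hq : q ≠ p) :
    ProcInv g' c' q := by
  have hP := hI.proc q
  have hv := D.ver_le
  have hf : ∀ t, Fresh g q t → Fresh g' q t := fun t => D.fresh (D.start q hq)
  have hb : ∀ t, Fresh g q t → BitSound g c q t → BitSound g' c' q t :=
    fun t => D.bitSound hI (D.start q hq)
  have hcl : ∀ t, Claim g c q t → Claim g' c' q t :=
    fun t => D.claim hI (D.start q hq) (D.seen q hq) (D.bit_mono q hq)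
  have hA := D.bit_mono q hq
  unfold ProcInv at hP ⊢
  rw [D.annOp q hq, D.loc q hq]
  split at hP
  · rwa [D.T q hq, D.lin q hq, D.tog q hq]
  · unfold ReadMem at hP ⊢
    rw [D.annResp q hq, D.T q hq, D.lin q hq, D.tog q hq]
    obtain ⟨⟨h1, h2⟩, h3⟩ := hP
    refine ⟨⟨h1, h2.imp id ?_⟩, ?_⟩
    · rintro ⟨k, h4, h5⟩
      exact ⟨k, h4.trans hv, by rwa [D.cont k h4]⟩
    · generalize c.loc q = l at h3
      cases l <;> simp only [ReadLoc, D.annResp q hq, D.start q hq] at h3 ⊢ <;> try exact h3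
      obtain ⟨h4, k, h5, h6, h7⟩ := h3
      exact ⟨h4, k, h5, h6.trans hv, by rwa [D.cont k h6]⟩
  · obtain ⟨h1, h2⟩ := hP
    constructor
    · unfold WriteMem at h1 ⊢
      rw [D.annResp q hq, D.T q hq, D.lin q hq, D.tog q hq, D.annCP q hq, D.RD q hq, D.seen q hq,
        D.start q hq]
      refine h1.imp id (Or.imp ?_ ?_)
      · rintro ⟨h3, h4, h5, h6, t, h7, h8⟩
        exact ⟨h3, h4, h5, h6.imp id (fun h => ⟨h.1, h.2.trans_le hv⟩), t, h7, hcl t h8⟩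
      · rintro ⟨h3, h4, h5, h6⟩
        exact ⟨h3, h4, h5.trans_le hv, h6⟩
    · generalize c.loc q = l at h2
      cases l <;> simp only [WriteLoc, D.annResp q hq, D.start q hq, D.annCP q hq, D.RD q hq,
        D.tog q hq, D.lin q hq, D.T q hq] at h2 ⊢ <;> grind

theorem ActsAs.owner (D : ActsAs p g c g' c') (hI : Inv g c) (hR : c'.mem.R = g'.cont g'.ver)
    (hq : q ≠ p) : Owner g' c' q := by
  intro v b h
  rcases D.ver_le.eq_or_lt with hv | hv
  · rw [hR, ← hv, D.cont _ le_rfl, ← hI.reg] at h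
    have := hI.owner q v b h
    rwa [← hv, D.lin q hq, D.tog q hq, D.start q hq, D.T q hq]
  · have := (D.cont_new _ hv le_rfl).1
    rw [hR] at h
    rw [h] at this
    exact absurd (Fin.succ_injective _ this) hq

/-- An action of `p` preserves the invariant if it preserves the part concerning `p`. -/
theorem ActsAs.inv (D : ActsAs p g c g' c') (hI : Inv g c) (hR : c'.mem.R = g'.cont g'.ver)
    (hs : g'.start p ≤ g'.ver) (hs' : g'.seen p ≤ g'.ver) (ho : Owner g' c' p)
    (hp : ProcInv g' c' p) : Inv g' c' where
  reg := hR
  start_le q := by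
    by_cases hq : q = p
    · rwa [hq]
    · rw [D.start q hq]; exact (hI.start_le q).trans D.ver_le
  seen_le q := by
    by_cases hq : q = p
    · rwa [hq]
    · rw [D.seen q hq]; exact (hI.seen_le q).trans D.ver_le
  owner q := by
    by_cases hq : q = p
    · rwa [hq]
    · exact D.owner hI hR hq
  proc q := by
    by_cases hq : q = p
    · rwa [hq]
    · exact D.procInv hI hq

end

/-! ### Preservation of the invariant -/

/-- The response of an operation linearized in the way `kd`, at a version where `R` contains `t`. -/
def Kind.resp (t : Triple N V) : Kind → Resp V
  | .read => .value t.1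
  | _ => .ack

/-- The effect of an action with event `e` on the ghost state `g` and on the announced operations
`ann`. All the information on the algorithm that is needed for the linearization is in this
relation: an operation is linearized at most once, at versions of `R` that are current during the
operation, with a matching response, and an operation that fails has not been linearized. -/
inductive GStep (ann : Fin N → Option (Op V)) (g : Ghost N V) :
    Option (Event (Fin N) (Op V) (Resp V)) → (Fin N → Option (Op V)) → Ghost N V → Prop
  | silent (seen) : GStep ann g none ann { g with seen := seen }
  | read (p k) (ha : ann p = some .read) (hl : g.lin p = none) (hk : g.start p ≤ k)
      (hk' : k ≤ g.ver) :
      GStep ann g none ann { g with lin := Function.update g.lin p (some (.read, k)) }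
  | skip (p v) (ha : ann p = some (.write v)) (hl : g.lin p = none) (hs : g.start p < g.ver) :
      GStep ann g none ann { g with lin := Function.update g.lin p (some (.skip, g.start p)) }
  | write (p v b) (ha : ann p = some (.write v)) (hl : g.lin p = none) (hs : g.start p ≤ g.ver) :
      GStep ann g none ann
        { g with
          ver := g.ver + 1
          cont := Function.update g.cont (g.ver + 1) (v, ident p, b)
          lin := Function.update g.lin p (some (.write, g.ver + 1)) }
  | invoke (p o tog) (ha : ann p = none) :
      GStep ann g (some (.inv p o)) (Function.update ann p (some o))
        { g with
          lin := Function.update g.lin p none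
          start := Function.update g.start p g.ver
          tog := tog }
  | ret (p o kd k) (ha : ann p = some o) (hl : g.lin p = some (kd, k)) :
      GStep ann g (some (.ret p (kd.resp (g.cont k)))) (Function.update ann p none) g
  | fail (p o) (ha : ann p = some o) (hl : g.lin p = none) :
      GStep ann g (some (.fail p)) (Function.update ann p none) g
  | crash : GStep ann g (some .crash) ann g

section

variable {p : Fin N} {g : Ghost N V} {c : Config N V}

/-- The local states that belong to `Write` and `Write.Recover` only. -/
def Local.IsWrite : Local N V → Prop
  | .idle | .rReadR | .rPersist _ | .rRecCheckResp | .retResp _ => False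
  | _ => True

/-- The local states that belong to `Read` and `Read.Recover` only. -/
def Local.IsRead : Local N V → Prop
  | .rReadR | .rPersist _ | .rRecCheckResp => True
  | _ => False

theorem ProcInv.write (h : ProcInv g c p) (hl : (c.loc p).IsWrite) :
    ∃ v, c.mem.annOp p = some (.write v) ∧ WriteMem g c p ∧ WriteLoc g c p v (c.loc p) := by
  unfold ProcInv at h
  split at h
  · rw [h.1] at hl; exact hl.elim
  · generalize c.loc p = l at h hl
    cases l <;> simp_all [ReadLoc, Local.IsWrite]
  · exact ⟨_, by assumption, h⟩

theorem ProcInv.read (h : ProcInv g c p) (hl : (c.loc p).IsRead) :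
    c.mem.annOp p = some .read ∧ ReadMem g c p ∧ ReadLoc g c p (c.loc p) := by
  unfold ProcInv at h
  split at h
  · rw [h.1] at hl; exact hl.elim
  · exact ⟨by assumption, h⟩
  · generalize c.loc p = l at h hl
    cases l <;> simp_all [WriteLoc, Local.IsRead]

theorem ProcInv.of_write {v : V} (h : c.mem.annOp p = some (.write v))
    (h1 : WriteMem g c p) (h2 : WriteLoc g c p v (c.loc p)) : ProcInv g c p := by
  simp only [ProcInv, h]; exact ⟨h1, h2⟩

theorem ProcInv.of_read (h : c.mem.annOp p = some .read)
    (h1 : ReadMem g c p) (h2 : ReadLoc g c p (c.loc p)) : ProcInv g c p := by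
  simp only [ProcInv, h]; exact ⟨h1, h2⟩

/-- Actions of `p` that change only its local state and its private variables other than `T_p`. -/
theorem actsAs_private {m' : Memory N V} {l' : Local N V}
    {lin' : Fin N → Option (Kind × ℕ)} {seen' : Fin N → ℕ}
    (hA : m'.A = c.mem.A) (hT : m'.T = c.mem.T)
    (hRD : ∀ q, q ≠ p → m'.RD q = c.mem.RD q)
    (hop : ∀ q, q ≠ p → m'.annOp q = c.mem.annOp q)
    (hresp : ∀ q, q ≠ p → m'.annResp q = c.mem.annResp q)
    (hCP : ∀ q, q ≠ p → m'.annCP q = c.mem.annCP q)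
    (hlin : ∀ q, q ≠ p → lin' q = g.lin q)
    (hlin' : ∀ x, g.lin p = some x → lin' p = some x)
    (hseen : ∀ q, q ≠ p → seen' q = g.seen q)
    (hl : ∀ q, NotPast q (c.loc p) → NotPast q l') :
    ActsAs p g c { g with lin := lin', seen := seen' }
      ⟨m', Function.update c.loc p l'⟩ where
  loc q hq := Function.update_of_ne hq _ _
  T q _ := by rw [hT]
  RD := hRD
  annOp := hop
  annResp := hresp
  annCP := hCP
  lin := hlin
  start _ _ := rfl
  tog _ _ := rfl
  seen := hseen
  ver_le := le_rfl
  cont _ _ := rfl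
  cont_new k h h' := absurd h' (not_le.2 h)
  bit_mono q _ j b h := by rwa [hA]
  bit_new q j b h := by rw [hA] at h; exact .inl h
  own q s b _ h := by
    refine .inr (h.imp (And.imp_left (hlin' _)) ?_)
    rintro ⟨h1, h2, h3, h4⟩
    exact ⟨h1, h2, by rwa [hT], by simpa using hl q h4⟩

/-- The invariant is preserved by actions of `p` that change only its local state and its private
variables other than `T_p`. -/
theorem Inv.private_step (hI : Inv g c) {m' : Memory N V} {l' : Local N V}
    {lin' : Fin N → Option (Kind × ℕ)} {seen' : Fin N → ℕ}
    (hR : m'.R = c.mem.R) (hA : m'.A = c.mem.A) (hT : m'.T = c.mem.T)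
    (hRD : ∀ q, q ≠ p → m'.RD q = c.mem.RD q)
    (hop : ∀ q, q ≠ p → m'.annOp q = c.mem.annOp q)
    (hresp : ∀ q, q ≠ p → m'.annResp q = c.mem.annResp q)
    (hCP : ∀ q, q ≠ p → m'.annCP q = c.mem.annCP q)
    (hlin : ∀ q, q ≠ p → lin' q = g.lin q)
    (hlin' : ∀ x, g.lin p = some x → lin' p = some x)
    (hseen : ∀ q, q ≠ p → seen' q = g.seen q) (hseen' : seen' p ≤ g.ver)
    (hl : ∀ q, NotPast q (c.loc p) → NotPast q l')
    (hp : (seen' p = g.seen p → ∀ t, Claim g c p t →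
        Claim { g with lin := lin', seen := seen' } ⟨m', Function.update c.loc p l'⟩ p t) →
      ProcInv { g with lin := lin', seen := seen' } ⟨m', Function.update c.loc p l'⟩ p) :
    Inv { g with lin := lin', seen := seen' } ⟨m', Function.update c.loc p l'⟩ := by
  have D := actsAs_private (m' := m') hA hT hRD hop hresp hCP hlin hlin' hseen hl
  refine D.inv hI (hR.trans hI.reg) (hI.start_le p) hseen' ?_
    (hp fun hs t => D.claim hI rfl hs (by simp [hA]))
  intro v b h
  have := hI.owner p v b (hR.symm.trans h)
  simp only [hT]
  exact this.imp (And.imp_left (hlin' _)) id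

/-- A step of `p` that changes only its local state. -/
theorem Inv.local_step (hI : Inv g c) {l' : Local N V}
    (hl : ∀ q, NotPast q (c.loc p) → NotPast q l')
    (hp : (∀ t, Claim g c p t → Claim g ⟨c.mem, Function.update c.loc p l'⟩ p t) →
      ProcInv g ⟨c.mem, Function.update c.loc p l'⟩ p) :
    Inv g ⟨c.mem, Function.update c.loc p l'⟩ :=
  hI.private_step (lin' := g.lin) (seen' := g.seen) rfl rfl rfl (fun _ _ => rfl) (fun _ _ => rfl)
    (fun _ _ => rfl) (fun _ _ => rfl) (fun _ _ => rfl) (fun _ => id) (fun _ _ => rfl)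
    (hI.seen_le p) hl (fun h => hp (h rfl))

theorem WriteMem.congr_loc {l' : Local N V}
    (hcl : ∀ t, Claim g c p t → Claim g ⟨c.mem, Function.update c.loc p l'⟩ p t)
    (h : WriteMem g c p) : WriteMem g ⟨c.mem, Function.update c.loc p l'⟩ p := by
  refine h.imp id (Or.imp ?_ id)
  rintro ⟨h3, h4, h5, h6, t, h7, h8⟩
  exact ⟨h3, h4, h5, h6, t, h7, hcl t h8⟩

/-- A step of a write of `p` that changes only its local state. -/
theorem Inv.local_step_write (hI : Inv g c) {l' : Local N V}
    (hw : (c.loc p).IsWrite) (hl : ∀ q, NotPast q (c.loc p) → NotPast q l')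
    (hp : ∀ v, c.mem.annOp p = some (.write v) → WriteMem g c p → WriteLoc g c p v (c.loc p) →
      WriteLoc g ⟨c.mem, Function.update c.loc p l'⟩ p v l') :
    Inv g ⟨c.mem, Function.update c.loc p l'⟩ := by
  obtain ⟨v, h1, h2, h3⟩ := (hI.proc p).write hw
  refine hI.local_step hl fun hcl => .of_write (v := v) h1 (h2.congr_loc hcl) ?_
  simpa using hp v h1 h2 h3

theorem Inv.step_wResetBit (hI : Inv g c) {val v : V} {j : Ident N} {b : Bool}
    (hl : c.loc p = .wResetBit val (v, j, b)) :
    Inv g ⟨{ c.mem with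
        A := fun i k d => if i = p ∧ k = j ∧ d = !b then false else c.mem.A i k d },
      Function.update c.loc p (.wReadT val (v, j, b))⟩ := by
  obtain ⟨w, h1, h2, h3⟩ := (hI.proc p).write (by simp [hl, Local.IsWrite])
  simp only [hl, WriteLoc] at h3
  refine ActsAs.inv (p := p) (g := g) (c := c) ?_ hI hI.reg (hI.start_le p) (hI.seen_le p)
    (hI.owner p) (.of_write (v := w) h1 ?_ ?_)
  · exact
    { loc := fun q hq => Function.update_of_ne hq _ _
      T := fun _ _ => rfl
      RD := fun _ _ => rfl
      annOp := fun _ _ => rfl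
      annResp := fun _ _ => rfl
      annCP := fun _ _ => rfl
      lin := fun _ _ => rfl
      start := fun _ _ => rfl
      tog := fun _ _ => rfl
      seen := fun _ _ => rfl
      ver_le := le_rfl
      cont := fun _ _ => rfl
      cont_new := fun k h h' => absurd h' (not_le.2 h)
      bit_mono := fun q hq k d h => by simpa [hq] using h
      bit_new := fun q k d h => by
        simp only [Bool.if_false_left, Bool.and_eq_true] at h
        exact .inl h.2
      own := fun q s d _ h => .inr <| by simpa [Own, hl, NotPast] using h }
  · rcases h2 with h2 | ⟨h2, -⟩ | ⟨h2, -⟩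
    · exact .inl h2
    · simp [h2] at h3
    · simp [h2] at h3
  · simpa [WriteLoc, BitSound, Fresh] using h3

theorem Inv.step_setBits (hI : Inv g c) {b : Bool} {i : Fin N}
    (hl : c.loc p = .setBits b i.val) :
    Inv g ⟨{ c.mem with
        A := fun k j d => if k = i ∧ j = ident p ∧ d = b then true else c.mem.A k j d },
      Function.update c.loc p (.setBits b (i.val + 1))⟩ := by
  obtain ⟨w, h1, h2, h3⟩ := (hI.proc p).write (by simp [hl, Local.IsWrite])
  simp only [hl, WriteLoc] at h3
  obtain ⟨rfl, h4, h5, h6⟩ := h3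
  have h2' : WriteMem g c p := h2
  rcases h2 with ⟨h2, -⟩ | ⟨h2, -⟩ | ⟨h2, h7, h8, h9⟩
  · simp [h2] at h5
  · simp [h2] at h5
  refine ActsAs.inv (p := p) (g := g) (c := c) ?_ hI hI.reg (hI.start_le p) (hI.seen_le p)
    (hI.owner p) (.of_write (v := w) h1 (.inr (.inr ⟨h2, h7, h8, h9⟩)) ?_)
  · exact
    { loc := fun q hq => Function.update_of_ne hq _ _
      T := fun _ _ => rfl
      RD := fun _ _ => rfl
      annOp := fun _ _ => rfl
      annResp := fun _ _ => rfl
      annCP := fun _ _ => rfl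
      lin := fun _ _ => rfl
      start := fun _ _ => rfl
      tog := fun _ _ => rfl
      seen := fun _ _ => rfl
      ver_le := le_rfl
      cont := fun _ _ => rfl
      cont_new := fun k h h' => absurd h' (not_le.2 h)
      bit_mono := fun q hq k d h => by simp [h]
      bit_new := fun q k d h => by
        simp only [Bool.if_true_left, Bool.or_eq_true, decide_eq_true_eq] at h
        exact h.symm.imp id fun h => ⟨h.2.1, h.2.2, h8⟩
      own := fun q s d _ h => by
        rcases h with h | ⟨h10, h11, h12, h13⟩
        · exact .inr (.inl h)
        · rw [hl] at h13
          simp only [NotPast] at h13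
          -- the only process whose bit is passed by this step is `i`, and that bit is set
          rcases h13.eq_or_lt with h14 | h14
          · left
            simp [← h11, Fin.ext h14.symm]
          · right; right
            refine ⟨h10, h11, h12, ?_⟩
            simpa [NotPast] using h14 }
  · simp only [Function.update_self, WriteLoc]
    exact ⟨trivial, i.isLt, h5, h6⟩

theorem Inv.step_flipT (hI : Inv g c) {b : Bool} (hl : c.loc p = .flipT b) :
    Inv g ⟨{ c.mem with T := Function.update c.mem.T p (!b) },
      Function.update c.loc p .setAck⟩ := by
  obtain ⟨w, h1, h2, h3⟩ := (hI.proc p).write (by simp [hl, Local.IsWrite])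
  simp only [hl, WriteLoc] at h3
  obtain ⟨rfl, h5, h6⟩ := h3
  rcases h2 with ⟨h2, -⟩ | ⟨h2, -⟩ | ⟨h2, h7, h8, h9, h10⟩
  · simp [h2] at h5
  · simp [h2] at h5
  refine ActsAs.inv (p := p) (g := g) (c := c) ?_ hI hI.reg (hI.start_le p) (hI.seen_le p)
    ?_ (.of_write (v := w) h1 (.inr (.inr ⟨h2, h7, h8, h9, .inl h6⟩)) ?_)
  · exact
    { loc := fun q hq => Function.update_of_ne hq _ _
      T := fun q hq => Function.update_of_ne hq _ _
      RD := fun _ _ => rfl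
      annOp := fun _ _ => rfl
      annResp := fun _ _ => rfl
      annCP := fun _ _ => rfl
      lin := fun _ _ => rfl
      start := fun _ _ => rfl
      tog := fun _ _ => rfl
      seen := fun _ _ => rfl
      ver_le := le_rfl
      cont := fun _ _ => rfl
      cont_new := fun k h h' => absurd h' (not_le.2 h)
      bit_mono := fun _ _ _ _ => id
      bit_new := fun _ _ _ => .inl
      own := fun q s d _ h => by
        rcases h with h | ⟨-, -, -, h⟩
        · exact .inr (.inl h)
        · rw [hl] at h; exact h.elim }
  · intro v b h
    rcases hI.owner p v b h with h | ⟨h, -⟩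
    · exact .inl h
    · omega
  · simp only [Function.update_self, WriteLoc]
    exact ⟨h5, h6, trivial⟩

/-- The write to `R`. The only processes whose knowledge about `R` could be invalidated are those
that have read an earlier triple of `p` with the same toggle index, and whose bit has not been set
since; by `BitComplete` there are none. -/
theorem Inv.step_wWriteR (hI : Inv g c) {v : V} {b : Bool} (hl : c.loc p = .wWriteR v b) :
    c.mem.annOp p = some (.write v) ∧ g.lin p = none ∧
    Inv { g with
          ver := g.ver + 1
          cont := Function.update g.cont (g.ver + 1) (v, ident p, b)
          lin := Function.update g.lin p (some (.write, g.ver + 1)) }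
      ⟨{ c.mem with R := (v, ident p, b) }, Function.update c.loc p (.setCP2 b)⟩ := by
  obtain ⟨w, h1, h2, h3⟩ := (hI.proc p).write (by simp [hl, Local.IsWrite])
  simp only [hl, WriteLoc] at h3
  obtain ⟨rfl, h5, rfl, h7⟩ := h3
  rcases h2 with ⟨h2, -⟩ | ⟨h2, h8, h9, h10, t, h11, h12⟩ | ⟨h2, -⟩
  · simp [h2] at h5
  swap
  · simp [h2] at h5
  refine ⟨h1, h7, ?_⟩
  have hs := hI.start_le p
  have hs' := hI.seen_le p
  have D : ActsAs p g c { g with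
          ver := g.ver + 1
          cont := Function.update g.cont (g.ver + 1) (v, ident p, g.tog p)
          lin := Function.update g.lin p (some (.write, g.ver + 1)) }
      ⟨{ c.mem with R := (v, ident p, g.tog p) }, Function.update c.loc p (.setCP2 (g.tog p))⟩ :=
    { loc := fun q hq => Function.update_of_ne hq _ _
      T := fun _ _ => rfl
      RD := fun _ _ => rfl
      annOp := fun _ _ => rfl
      annResp := fun _ _ => rfl
      annCP := fun _ _ => rfl
      lin := fun q hq => Function.update_of_ne hq _ _
      start := fun _ _ => rfl
      tog := fun _ _ => rfl
      seen := fun _ _ => rfl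
      ver_le := Nat.le_succ _
      cont := fun k hk => Function.update_of_ne (by omega) _ _
      cont_new := fun k h h' => by
        obtain rfl : k = g.ver + 1 := by simp only at h'; omega
        simp [h7]
      bit_mono := fun _ _ _ _ => id
      bit_new := fun _ _ _ => .inl
      own := fun q s d _ h => by
        rcases h with ⟨h, -⟩ | ⟨h13, h14, h15, -⟩
        · simp [h7] at h
        · exact .inr (.inr ⟨h13, h14, h15, by simp [NotPast]⟩) }
  refine D.inv hI (by simp) (by simp only; omega) (by simp only; omega) ?_
    (.of_write (v := v) h1 (.inr (.inl ⟨h2, h8, h9, .inr ⟨⟨g.ver + 1, by simp⟩, ?_⟩, t, h11, ?_⟩)) ?_)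
  · intro v b h
    simp only [Prod.mk.injEq] at h
    exact .inl ⟨by simp, h.2.2⟩
  · simp only; omega
  · exact D.claim hI rfl rfl (fun _ _ => id) h12
  · simp only [Function.update_self, WriteLoc]
    exact ⟨trivial, by omega, h8, t, h11⟩

/-- Once `p` has found `R` unchanged, the assertions about `R` hold for the triple it has read. -/
theorem Inv.claim_of_reread (hI : Inv g c) {t : Triple N V} {l' : Local N V} (hR : c.mem.R = t)
    (hf : Fresh g p t) (hb : BitSound g c p t) (hl : ∀ q, NotPast q l') :
    Claim { g with seen := Function.update g.seen p g.ver }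
      ⟨c.mem, Function.update c.loc p l'⟩ p t := by
  refine ⟨hf, hb, .inr ⟨fun k hk hk' => ?_, fun q hq => ?_⟩⟩
  · simp only [Function.update_self] at hk hk'; omega
  · simp only [Function.update_self, Own]
    refine (hI.owner q t.1 t.2.2 (by rw [hR, ← hq])).imp id ?_
    rintro ⟨h1, h2, h3⟩
    refine ⟨h1, h2, h3, ?_⟩
    by_cases hqp : q = p
    · subst hqp; simpa using hl q
    -- a process that sets bits has been invoked before the last write to `R`
    · rw [Function.update_of_ne hqp]
      cases hlq : c.loc q with
      | setBits d j =>
        obtain ⟨w, -, h4, h5⟩ := (hI.proc q).write (by simp [hlq, Local.IsWrite])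
        simp only [hlq, WriteLoc] at h5
        rcases h4 with ⟨h4, -⟩ | ⟨h4, -⟩ | ⟨-, -, h4, -⟩
        · simp [h4] at h5
        · simp [h4] at h5
        · omega
      | flipT d =>
        obtain ⟨w, -, h4, h5⟩ := (hI.proc q).write (by simp [hlq, Local.IsWrite])
        simp only [hlq, WriteLoc] at h5
        rcases h4 with ⟨h4, -⟩ | ⟨h4, -⟩ | ⟨-, -, h4, -⟩
        · simp [h4] at h5
        · simp [h4] at h5
        · omega
      | _ => trivial

theorem Inv.instr (hI : Inv g c) {m' : Memory N V} {l' : Local N V}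
    (h : Instr p c.mem (c.loc p) m' l') :
    ∃ g', GStep c.mem.annOp g none m'.annOp g' ∧ Inv g' ⟨m', Function.update c.loc p l'⟩ := by
  have hsil : GStep c.mem.annOp g none c.mem.annOp g := .silent g.seen
  have hP := hI.proc p
  generalize hm : c.mem = m at h
  generalize hl : c.loc p = l at h
  cases h <;> subst hm
  case wReadR val =>
    refine ⟨g, hsil, hI.local_step_write (by simp [hl, Local.IsWrite]) (by simp [NotPast]) ?_⟩
    intro v _ _ h3
    simp only [hl, WriteLoc] at h3 ⊢
    exact ⟨h3.1, h3.2, g.ver, hI.start_le p, le_rfl, hI.reg.symm⟩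
  case wResetBit => exact ⟨g, hsil, hI.step_wResetBit hl⟩
  case wReadT val t =>
    refine ⟨g, hsil, hI.local_step_write (by simp [hl, Local.IsWrite]) (by simp [NotPast]) ?_⟩
    intro v _ h2 h3
    simp only [hl, WriteLoc] at h3 ⊢
    obtain ⟨h4, h5, h6, h7⟩ := h3
    rcases h2 with ⟨-, -, -, h2⟩ | ⟨h2, -⟩ | ⟨h2, -⟩
    · exact ⟨h4, h5, h6, h7, h2⟩
    · simp [h2] at h5
    · simp [h2] at h5
  case wPersist val t b =>
    obtain ⟨w, h1, h2, h3⟩ := hP.write (by simp [hl, Local.IsWrite])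
    simp only [hl, WriteLoc] at h3
    refine ⟨g, hsil, hI.private_step (lin' := g.lin) (seen' := g.seen) rfl rfl rfl
      (fun q hq => Function.update_of_ne hq _ _) (fun _ _ => rfl) (fun _ _ => rfl)
      (fun _ _ => rfl) (fun _ _ => rfl) (fun _ => id) (fun _ _ => rfl) (hI.seen_le p)
      (by simp [NotPast]) fun _ => .of_write (v := w) h1 ?_ ?_⟩
    · rcases h2 with h2 | ⟨h2, -⟩ | ⟨h2, -⟩
      · exact .inl h2
      · simp [h2] at h3
      · simp [h2] at h3
    · simp only [Function.update_self, WriteLoc, and_true]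
      exact h3
  case wRereadR_ne val t b h =>
    refine ⟨g, hsil, hI.local_step_write (by simp [hl, Local.IsWrite]) (by simp [NotPast]) ?_⟩
    intro v _ h2 h3
    simp only [hl, WriteLoc] at h3 ⊢
    obtain ⟨-, h5, h6, -, h7, h8⟩ := h3
    refine ⟨h7, ?_, ?_, t, h8⟩
    · obtain ⟨k, h9, h10, rfl⟩ := h6
      refine lt_of_le_of_lt h9 (lt_of_le_of_ne h10 ?_)
      rintro rfl
      exact h hI.reg
    · rcases h2 with ⟨-, h2, -⟩ | ⟨h2, -⟩ | ⟨h2, -⟩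
      · exact h2
      · simp [h2] at h5
      · simp [h2] at h5
  case wRereadR_eq val t b h =>
    obtain ⟨w, h1, h2, h3⟩ := hP.write (by simp [hl, Local.IsWrite])
    simp only [hl, WriteLoc] at h3
    obtain ⟨h4, h5, h6, h7, h8, h9⟩ := h3
    rcases h2 with h2 | ⟨h2, -⟩ | ⟨h2, -⟩
    · refine ⟨_, .silent (Function.update g.seen p g.ver), hI.private_step (lin' := g.lin)
        (seen' := Function.update g.seen p g.ver) rfl rfl rfl
        (fun _ _ => rfl) (fun _ _ => rfl) (fun _ _ => rfl)
        (fun _ _ => rfl) (fun _ _ => rfl) (fun _ => id) (fun q hq => Function.update_of_ne hq _ _)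
        (by simp) (by simp [NotPast]) fun _ => .of_write (v := w) h1 (.inl h2) ?_⟩
      simp only [Function.update_self, WriteLoc]
      exact ⟨h4, h5, h8, t, h9, hI.claim_of_reread h h6 h7 (by simp [NotPast])⟩
    · simp [h2] at h5
    · simp [h2] at h5
  case wSetCP1 val b =>
    obtain ⟨w, h1, h2, h3⟩ := hP.write (by simp [hl, Local.IsWrite])
    simp only [hl, WriteLoc] at h3
    obtain ⟨h4, h5, h6, t, h7, h8⟩ := h3
    rcases h2 with ⟨-, h2, h9, h10⟩ | ⟨h2, -⟩ | ⟨h2, -⟩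
    · refine ⟨g, hsil, hI.private_step (lin' := g.lin) (seen' := g.seen) rfl rfl rfl
        (fun _ _ => rfl) (fun _ _ => rfl) (fun _ _ => rfl)
        (fun q hq => Function.update_of_ne hq _ _) (fun _ _ => rfl) (fun _ => id) (fun _ _ => rfl)
        (hI.seen_le p) (by simp [NotPast]) fun hcl => .of_write (v := w) h1 ?_ ?_⟩
      · exact .inr (.inl ⟨by simp, h2, h10, .inl h9, t, h6 ▸ h7, hcl rfl t h8⟩)
      · simp only [Function.update_self, WriteLoc]
        exact ⟨h4, trivial, h6, h9⟩
    · simp [h2] at h5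
    · simp [h2] at h5
  case wWriteR v b =>
    obtain ⟨h1, h2, h3⟩ := hI.step_wWriteR hl
    exact ⟨_, .write p v b h1 h2 (hI.start_le p), h3⟩
  case setCP2 b =>
    obtain ⟨w, h1, h2, h3⟩ := hP.write (by simp [hl, Local.IsWrite])
    simp only [hl, WriteLoc] at h3
    obtain ⟨rfl, h5, h6, t, h7⟩ := h3
    -- the operation is linearized here, unless it has been already
    by_cases hlin : g.lin p = none
    · refine ⟨_, .skip p w h1 hlin h5, hI.private_step
        (lin' := Function.update g.lin p (some (.skip, g.start p))) (seen' := g.seen) rfl rfl rfl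
        (fun _ _ => rfl) (fun _ _ => rfl) (fun _ _ => rfl)
        (fun q hq => Function.update_of_ne hq _ _) (fun q hq => Function.update_of_ne hq _ _)
        (by simp [hlin]) (fun _ _ => rfl)
        (hI.seen_le p) (by simp [NotPast]) fun _ => .of_write (v := w) h1 ?_ ?_⟩
      · exact .inr (.inr ⟨by simp, ⟨_, _, Function.update_self .., by simp⟩, h5, ⟨t, h7⟩, .inl h6⟩)
      · simp only [Function.update_self, WriteLoc]
        exact ⟨trivial, Nat.zero_le _, trivial, h6⟩
    · refine ⟨g, hsil, hI.private_step (lin' := g.lin) (seen' := g.seen) rfl rfl rfl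
        (fun _ _ => rfl) (fun _ _ => rfl) (fun _ _ => rfl)
        (fun q hq => Function.update_of_ne hq _ _) (fun _ _ => rfl) (fun _ => id) (fun _ _ => rfl)
        (hI.seen_le p) (by simp [NotPast]) fun _ => .of_write (v := w) h1 ?_ ?_⟩
      · refine .inr (.inr ⟨by simp, ?_, h5, ⟨t, h7⟩, .inl h6⟩)
        rcases h2 with ⟨-, -, h2, -⟩ | ⟨-, -, -, h2 | ⟨⟨k, h2⟩, -⟩, -⟩ | ⟨-, h2, -⟩
        · exact absurd h2 hlin
        · exact absurd h2 hlin
        · exact ⟨_, _, h2, by simp⟩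
        · exact h2
      · simp only [Function.update_self, WriteLoc]
        exact ⟨trivial, Nat.zero_le _, trivial, h6⟩
  case setBits b i => exact ⟨g, hsil, hI.step_setBits hl⟩
  case setBits_end b =>
    refine ⟨g, hsil, hI.local_step_write (by simp [hl, Local.IsWrite]) ?_ ?_⟩
    · intro q hq
      rw [hl] at hq
      exact absurd hq (not_le.2 q.isLt)
    · intro v _ _ h3
      simp only [hl, WriteLoc] at h3 ⊢
      exact ⟨h3.1, h3.2.2⟩
  case flipT b => exact ⟨g, hsil, hI.step_flipT hl⟩
  case setAck =>
    obtain ⟨w, h1, h2, h3⟩ := hP.write (by simp [hl, Local.IsWrite])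
    simp only [hl, WriteLoc] at h3
    obtain ⟨h3, h4, h5⟩ := h3
    rcases h2 with ⟨h2, -⟩ | ⟨h2, -⟩ | ⟨h2, h6, h7, h8, -⟩
    · simp [h2] at h3
    · simp [h2] at h3
    refine ⟨g, hsil, hI.private_step (lin' := g.lin) (seen' := g.seen) rfl rfl rfl
        (fun _ _ => rfl) (fun _ _ => rfl) (fun q hq => Function.update_of_ne hq _ _)
        (fun _ _ => rfl) (fun _ _ => rfl) (fun _ => id) (fun _ _ => rfl)
        (hI.seen_le p) (by simp [NotPast]) fun _ => .of_write (v := w) h1 ?_ ?_⟩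
    · exact .inr (.inr ⟨h2, h6, h7, h8, .inr ⟨by simp, h5⟩⟩)
    · simp [WriteLoc]
  case recReadRD =>
    refine ⟨g, hsil, hI.local_step_write (by simp [hl, Local.IsWrite]) (by simp [NotPast]) ?_⟩
    intro v _ _ h3
    simp [WriteLoc]
  case recCheckResp_set rd h =>
    refine ⟨g, hsil, hI.local_step_write (by simp [hl, Local.IsWrite]) (by simp [NotPast]) ?_⟩
    intro v _ _ h3
    exact ⟨rfl, h⟩
  case recCheckResp_bot rd h =>
    refine ⟨g, hsil, hI.local_step_write (by simp [hl, Local.IsWrite]) (by simp [NotPast]) ?_⟩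
    intro v _ _ h3
    rw [hl] at h3
    exact ⟨h3, h⟩
  case recCheckCP0_eq rd h =>
    refine ⟨g, hsil, hI.local_step_write (by simp [hl, Local.IsWrite]) (by simp [NotPast]) ?_⟩
    intro v _ h2 h3
    rcases h2 with ⟨-, -, h2, -⟩ | ⟨h2, -⟩ | ⟨h2, -⟩
    · exact h2
    · simp [h2] at h
    · simp [h2] at h
  case recCheckCP0_ne rd h =>
    refine ⟨g, hsil, hI.local_step_write (by simp [hl, Local.IsWrite]) (by simp [NotPast]) ?_⟩
    intro v _ _ h3
    rw [hl] at h3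
    exact ⟨h3.1, h3.2, h⟩
  case recCheckCP1_eq b t h =>
    refine ⟨g, hsil, hI.local_step_write (by simp [hl, Local.IsWrite]) (by simp [NotPast]) ?_⟩
    intro v _ _ h3
    rw [hl] at h3
    exact ⟨h3.1.symm, h⟩
  case recCheckCP1_ne b t h =>
    refine ⟨g, hsil, hI.local_step_write (by simp [hl, Local.IsWrite]) (by simp [NotPast]) ?_⟩
    intro v _ h2 h3
    simp only [hl, WriteLoc] at h3
    obtain ⟨h3, h4, h5⟩ := h3
    rcases h2 with ⟨h2, -⟩ | ⟨h2, -⟩ | ⟨-, -, h6, ⟨t', h7⟩, -⟩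
    · exact absurd h2 h5
    · exact absurd h2 h
    · simp only [h7, Option.some.injEq, Prod.mk.injEq] at h3
      exact ⟨h3.1, h6, h4, t', h3.1 ▸ h7⟩
  case recCheckR_eq b t h =>
    refine ⟨g, hsil, hI.local_step_write (by simp [hl, Local.IsWrite]) (by simp [NotPast]) ?_⟩
    intro v _ h2 h3
    simp only [hl, WriteLoc] at h3
    obtain ⟨h3, h4⟩ := h3
    refine ⟨h3, h4, ?_⟩
    rcases h2 with ⟨h2, -⟩ | ⟨-, -, -, h5, t', h6, -, -, h7⟩ | ⟨h2, -⟩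
    · simp [h2] at h4
    · simp only [h6, Option.some.injEq, Prod.mk.injEq] at h3
      obtain ⟨rfl, rfl⟩ := h3
      rcases h5 with h5 | ⟨-, h5⟩
      · exact .inl h5
      -- `R` contains again the triple that `p` has overwritten, so the bit has been set
      · refine .inr (h7.resolve_right fun h8 => h8.1 g.ver h5 le_rfl ?_)
        rw [← hI.reg, h]
        exact ⟨rfl, rfl⟩
    · simp [h2] at h4
  case recCheckR_ne b t h =>
    refine ⟨g, hsil, hI.local_step_write (by simp [hl, Local.IsWrite]) (by simp [NotPast]) ?_⟩
    intro v _ h2 h3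
    simp only [hl, WriteLoc] at h3
    obtain ⟨h3, h4⟩ := h3
    rcases h2 with ⟨h2, -⟩ | ⟨-, h5, -, -, t', h6, ⟨k, h7, h8, h9⟩, -⟩ | ⟨h2, -⟩
    · simp [h2] at h4
    · simp only [h6, Option.some.injEq, Prod.mk.injEq] at h3
      obtain ⟨rfl, rfl⟩ := h3
      refine ⟨rfl, lt_of_le_of_lt h7 (lt_of_le_of_ne h8 ?_), h5, t', h6⟩
      rintro rfl
      exact h (hI.reg.trans h9)
    · simp [h2] at h4
  case recCheckBit_zero b v j d h =>
    refine ⟨g, hsil, hI.local_step_write (by simp [hl, Local.IsWrite]) (by simp [NotPast]) ?_⟩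
    intro v _ h2 h3
    simp only [hl, WriteLoc, h] at h3
    exact h3.2.2.resolve_right (by simp)
  case recCheckBit_one b v j d h =>
    refine ⟨g, hsil, hI.local_step_write (by simp [hl, Local.IsWrite]) (by simp [NotPast]) ?_⟩
    intro v _ h2 h3
    simp only [hl, WriteLoc] at h3
    obtain ⟨h3, h4, -⟩ := h3
    rcases h2 with ⟨h2, -⟩ | ⟨-, h5, -, -, t', h6, -, h7, -⟩ | ⟨h2, -⟩
    · simp [h2] at h4
    · simp only [h6, Option.some.injEq, Prod.mk.injEq] at h3
      obtain ⟨rfl, rfl⟩ := h3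
      exact ⟨rfl, h7 h, h5, _, h6⟩
    · simp [h2] at h4
  case rReadR =>
    obtain ⟨h1, h2, h3⟩ := hP.read (by simp [hl, Local.IsRead])
    simp only [hl, ReadLoc] at h3
    refine ⟨g, hsil, hI.local_step (by simp [NotPast]) fun _ => .of_read h1 h2 ?_⟩
    simp only [Function.update_self, ReadLoc]
    exact ⟨h3, g.ver, hI.start_le p, le_rfl, by rw [hI.reg]⟩
  case rPersist v =>
    obtain ⟨h1, h2, h3⟩ := hP.read (by simp [hl, Local.IsRead])
    simp only [hl, ReadLoc] at h3
    obtain ⟨h3, k, h4, h5, rfl⟩ := h3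
    obtain ⟨h2, ⟨-, h6⟩ | ⟨_, -, h6, -⟩⟩ := h2
    · refine ⟨_, .read p k h1 h6 h4 h5, hI.private_step
        (lin' := Function.update g.lin p (some (.read, k))) (seen' := g.seen) rfl rfl rfl
        (fun _ _ => rfl) (fun _ _ => rfl) (fun q hq => Function.update_of_ne hq _ _)
        (fun _ _ => rfl) (fun q hq => Function.update_of_ne hq _ _)
        (by simp [h6]) (fun _ _ => rfl)
        (hI.seen_le p) (by simp [NotPast]) fun _ => .of_read h1 ?_ ?_⟩
      · exact ⟨h2, .inr ⟨k, h5, by simp, by simp⟩⟩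
      · simp [ReadLoc]
    · simp [h3] at h6
  case rRecCheckResp_bot h =>
    obtain ⟨h1, h2, h3⟩ := hP.read (by simp [hl, Local.IsRead])
    refine ⟨g, hsil, hI.local_step (by simp [NotPast]) fun _ => .of_read h1 h2 ?_⟩
    simpa only [Function.update_self, ReadLoc] using h
  case rRecCheckResp_set r h =>
    obtain ⟨h1, h2, h3⟩ := hP.read (by simp [hl, Local.IsRead])
    refine ⟨g, hsil, hI.local_step (by simp [NotPast]) fun _ => .of_read h1 h2 ?_⟩
    simpa only [Function.update_self, ReadLoc] using h

theorem Inv.invoke (hI : Inv g c) {o : Op V} (ha : c.mem.annOp p = none) :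
    Inv { g with
          lin := Function.update g.lin p none
          start := Function.update g.start p g.ver
          tog := Function.update g.tog p (c.mem.T p) }
      { mem := { c.mem with
          annOp := Function.update c.mem.annOp p (some o)
          annResp := Function.update c.mem.annResp p none
          annCP := Function.update c.mem.annCP p 0 }
        loc := Function.update c.loc p (entry o) } := by
  have hP := hI.proc p
  simp only [ProcInv, ha] at hP
  obtain ⟨h1, h2⟩ := hP
  refine ActsAs.inv (p := p) (g := g) (c := c) ?_ hI hI.reg (by simp) (hI.seen_le p) ?_ ?_
  · exact
    { loc := fun q hq => Function.update_of_ne hq _ _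
      T := fun _ _ => rfl
      RD := fun _ _ => rfl
      annOp := fun q hq => Function.update_of_ne hq _ _
      annResp := fun q hq => Function.update_of_ne hq _ _
      annCP := fun q hq => Function.update_of_ne hq _ _
      lin := fun q hq => Function.update_of_ne hq _ _
      start := fun q hq => Function.update_of_ne hq _ _
      tog := fun q hq => Function.update_of_ne hq _ _
      seen := fun _ _ => rfl
      ver_le := le_rfl
      cont := fun _ _ => rfl
      cont_new := fun k h h' => absurd h' (not_le.2 h)
      bit_mono := fun _ _ _ _ => id
      bit_new := fun _ _ _ => .inl
      own := fun q s b hs h => by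
        refine .inr (.inr ?_)
        have hn : NotPast q (entry o : Local N V) := by cases o <;> trivial
        simp only [Function.update_self, true_and]
        refine ⟨hs, ?_, hn⟩
        -- after a write that took effect, the toggle index has been flipped
        rcases h with ⟨h, rfl⟩ | ⟨-, h3, h4, -⟩
        · rw [h2, h, settledTog]
        · rw [h4, h3] }
  · intro v b h
    right
    simp only [Function.update_self, le_refl, true_and, and_true]
    rcases hI.owner p v b h with ⟨h3, rfl⟩ | ⟨-, h3, h4⟩
    · rw [h2, h3, settledTog]
    · rw [h4, h3]
  · cases o with
    | read =>
      refine .of_read (by simp) ⟨by simp, .inl (by simp)⟩ ?_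
      simp [entry, ReadLoc]
    | write v =>
      refine .of_write (v := v) (by simp) (.inl (by simp)) ?_
      simp [entry, WriteLoc]

/-- The end of an operation. -/
theorem Inv.finish (hI : Inv g c) (hT : c.mem.T p = settledTog (g.lin p) (g.tog p)) :
    Inv g { mem := { c.mem with annOp := Function.update c.mem.annOp p none }
            loc := Function.update c.loc p .idle } :=
  hI.private_step (lin' := g.lin) (seen' := g.seen) rfl rfl rfl
    (fun _ _ => rfl) (fun q hq => Function.update_of_ne hq _ _) (fun _ _ => rfl)
    (fun _ _ => rfl) (fun _ _ => rfl) (fun _ => id) (fun _ _ => rfl) (hI.seen_le p)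
    (by simp [NotPast]) (fun _ => by simpa [ProcInv] using hT)

theorem Inv.crash (hI : Inv g c) : Inv g { c with loc := fun _ => .idle } := by
  refine ⟨hI.reg, hI.start_le, hI.seen_le, hI.owner, fun q => ?_⟩
  have hcl : ∀ t, Claim g c q t → Claim g { c with loc := fun _ => .idle } q t := by
    rintro t ⟨h1, h2, h3⟩
    exact ⟨h1, h2, h3.imp id (And.imp_right fun h r hr =>
      (h r hr).imp id fun h => ⟨h.1, h.2.1, h.2.2.1, trivial⟩)⟩
  have hP := hI.proc q
  unfold ProcInv at hP ⊢
  simp only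
  split at hP
  · exact ⟨trivial, hP.2⟩
  · exact ⟨hP.1, trivial⟩
  · refine ⟨hP.1.imp id (Or.imp ?_ id), trivial⟩
    rintro ⟨h3, h4, h5, h6, t, h7, h8⟩
    exact ⟨h3, h4, h5, h6, t, h7, hcl t h8⟩

/-- The invariant is preserved by every transition. -/
theorem Inv.step (hI : Inv g c) {a : Action N V} {c' : Config N V} (h : Step c a c') :
    ∃ g', GStep c.mem.annOp g a.event c'.mem.annOp g' ∧ Inv g' c' := by
  cases h with
  | invoke p o hl ha => exact ⟨_, .invoke p o _ ha, hI.invoke ha⟩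
  | recover p o hl ha =>
    refine ⟨g, .silent g.seen, hI.local_step ?_ fun hcl => ?_⟩
    · intro q _
      cases o <;> trivial
    · have hP := hI.proc p
      cases o with
      | read =>
        simp only [ProcInv, ha] at hP
        refine .of_read ha hP.1 ?_
        simp [recEntry, ReadLoc]
      | write v =>
        simp only [ProcInv, ha] at hP
        refine .of_write (v := v) ha (hP.1.congr_loc hcl) ?_
        simp [recEntry, WriteLoc]
  | step p m' l' h => exact hI.instr h
  | ret p r hl =>
    have hP := hI.proc p
    unfold ProcInv at hP
    rw [hl] at hP
    split at hP
    · exact absurd hP.1 (by simp)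
    case h_2 ha =>
      obtain ⟨⟨h1, ⟨h2, -⟩ | ⟨k, -, h2, h3⟩⟩, h4⟩ := hP
      · simp [ReadLoc, h2] at h4
      · simp only [ReadLoc, h2, Option.some.injEq] at h4
        subst h4
        exact ⟨g, .ret p _ _ _ ha h3, hI.finish (by simp [h1, h3, settledTog])⟩
    case h_3 v ha =>
      obtain ⟨h1, h2⟩ := hP
      simp only [WriteLoc] at h2
      obtain ⟨rfl, h2⟩ := h2
      rcases h1 with ⟨-, h1, -⟩ | ⟨-, h1, -⟩ | ⟨-, ⟨kd, k, h3, h4⟩, -, -, h5 | ⟨-, h5⟩⟩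
      · exact absurd h1 h2
      · exact absurd h1 h2
      · exact absurd h5 h2
      · have h6 := GStep.ret (g := g) p _ _ _ ha h3
        cases kd
        · exact ⟨g, h6, hI.finish (by rw [h5, h3, settledTog])⟩
        · exact absurd rfl h4
        · exact ⟨g, h6, hI.finish (by rw [h5, h3, settledTog])⟩
  | fail p hl =>
    obtain ⟨v, ha, h1, h2⟩ := (hI.proc p).write (by simp [hl, Local.IsWrite])
    simp only [hl, WriteLoc] at h2
    refine ⟨g, .fail p _ ha h2, hI.finish ?_⟩
    rcases h1 with ⟨-, -, -, h1⟩ | ⟨-, -, h1, -⟩ | ⟨-, ⟨kd, k, h1, -⟩, -⟩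
    · simp [h1, h2, settledTog]
    · simp [h1, h2, settledTog]
    · simp [h2] at h1
  | crash => exact ⟨g, .crash, hI.crash⟩

end

end DetectableRW

/-! ### Pending operations of a history -/

namespace CrashRecovery

section

variable {P Op Resp σ : Type*} {h : List (Event P Op Resp)} {e e' : Event P Op Resp}
  {p : P} {o : Op} {i j : ℕ}

/-- In the history `h`, process `p` invokes `o` at position `i`, and this operation has not ended. -/
def Pending (h : List (Event P Op Resp)) (p : P) (o : Op) (i : ℕ) : Prop :=
  h[i]? = some (.inv p o) ∧ ∀ j, i < j → ∀ e, h[j]? = some e → ¬ e.EndsOp p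

theorem not_endsOp_inv {q : P} : ¬ (Event.inv q o : Event P Op Resp).EndsOp p := by
  simp [Event.EndsOp]

theorem not_endsOp_crash : ¬ (Event.crash : Event P Op Resp).EndsOp p := by
  simp [Event.EndsOp]

theorem EndsWith.lt (H : EndsWith h i j e) : i < j :=
  let ⟨_, _, _, hij, _⟩ := H
  hij

theorem EndsWith.lt_length (H : EndsWith h i j e) : j < h.length :=
  let ⟨_, _, _, _, hj, _⟩ := H
  (List.getElem?_eq_some_iff.1 hj).1

theorem Pending.not_endsWith (H : Pending h p o i) : ¬ EndsWith h i j e := by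
  rintro ⟨q, o', h1, h2, h3, h4, -⟩
  rw [H.1] at h1
  simp only [Option.some.injEq, Event.inv.injEq] at h1
  obtain ⟨rfl, rfl⟩ := h1
  exact H.2 j h2 e h3 h4

theorem getElem?_concat_iff {α : Type*} {l : List α} {a b : α} :
    (l ++ [a])[i]? = some b ↔ l[i]? = some b ∨ (i = l.length ∧ b = a) := by
  rcases lt_trichotomy i l.length with h | rfl | h
  · rw [List.getElem?_append_left h]
    simp [h.ne]
  · simp [eq_comm]
  · rw [List.getElem?_eq_none (by simp; omega), List.getElem?_eq_none h.le]
    simp [h.ne']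

theorem EndsWith.of_concat (H : EndsWith (h ++ [e]) i j e') :
    EndsWith h i j e' ∨ (j = h.length ∧ e' = e ∧ ∃ p o, e.EndsOp p ∧ Pending h p o i) := by
  obtain ⟨p, o, h1, h2, h3, h4, h5⟩ := H
  have hi : h[i]? = some (.inv p o) := by
    rcases getElem?_concat_iff.1 h1 with h1 | ⟨h1, -⟩
    · exact h1
    · have := (List.getElem?_eq_some_iff.1 h3).1
      simp at this
      omega
  rcases getElem?_concat_iff.1 h3 with h3 | ⟨rfl, rfl⟩
  · exact .inl ⟨p, o, hi, h2, h3, h4, fun k hk hk' a ha =>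
      h5 k hk hk' a (getElem?_concat_iff.2 (.inl ha))⟩
  · exact .inr ⟨rfl, rfl, p, o, h4, hi, fun k hk a ha =>
      h5 k hk (List.getElem?_eq_some_iff.1 ha).1 a (getElem?_concat_iff.2 (.inl ha))⟩

theorem pending_concat_iff :
    Pending (h ++ [e]) p o i ↔
      (Pending h p o i ∧ ¬ e.EndsOp p) ∨ (i = h.length ∧ e = .inv p o) := by
  constructor
  · rintro ⟨h1, h2⟩
    rcases getElem?_concat_iff.1 h1 with h1 | ⟨rfl, rfl⟩
    · exact .inl ⟨⟨h1, fun j hj a ha => h2 j hj a (getElem?_concat_iff.2 (.inl ha))⟩,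
        h2 h.length (List.getElem?_eq_some_iff.1 h1).1 e (by simp)⟩
    · exact .inr ⟨rfl, rfl⟩
  · rintro (⟨⟨h1, h2⟩, h3⟩ | ⟨rfl, rfl⟩)
    · refine ⟨getElem?_concat_iff.2 (.inl h1), fun j hj a ha => ?_⟩
      rcases getElem?_concat_iff.1 ha with ha | ⟨-, rfl⟩
      · exact h2 j hj a ha
      · exact h3
    · refine ⟨by simp, fun j hj a ha => ?_⟩
      have := (List.getElem?_eq_some_iff.1 ha).1
      simp at this
      omega

theorem legal_append {δ : σ → Op → σ × Resp} {s : σ} {l l' : List (Op × Resp)} :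
    Legal δ s (l ++ l') ↔
      Legal δ s l ∧ Legal δ (l.foldl (fun s x => (δ s x.1).1) s) l' := by
  induction l generalizing s with
  | nil => simp [Legal]
  | cons x l ih => simp [Legal, ih, and_assoc]

end

end CrashRecovery

namespace DetectableRW

open CrashRecovery

variable {N : ℕ} {V : Type*}

/-! ### The linearization attached to an execution -/

/-- `kd.Matches t o`: the operation `o` can be linearized in the way `kd` at a version where `R`
contains `t`. -/
def Kind.Matches (t : Triple N V) : Kind → Op V → Prop
  | .write, o => o = .write t.1
  | .read, o => o = .read
  | .skip, o => ∃ v, o = .write v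

/-- The first version at which an operation invoked at version `v` can be linearized. -/
def Kind.first (v : ℕ) : Kind → ℕ
  | .write => v + 1
  | _ => v

/-- The version that must have been reached when an operation linearized at version `k` ends. -/
def Kind.last (k : ℕ) : Kind → ℕ
  | .skip => k + 1
  | _ => k

theorem Kind.le_first (kd : Kind) (v : ℕ) : v ≤ kd.first v := by
  cases kd <;> simp [first]

theorem Kind.le_last (kd : Kind) (k : ℕ) : k ≤ kd.last k := by
  cases kd <;> simp [last]

/-- The relation between a history `h` and the ghost state. Operations are identified with the
positions of their invocations: `lin i` tells how the operation `i` has been linearized, `inv p` is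
the pending operation of `p`, if there is one, and `vt j` is the version of `R` at the time of the
event at position `j`. -/
structure Hist (vinit : V) (h : List (Event (Fin N) (Op V) (Resp V)))
    (ann : Fin N → Option (Op V)) (g : Ghost N V)
    (lin : ℕ → Option (Kind × ℕ)) (vt : ℕ → ℕ) (inv : Fin N → ℕ) : Prop where
  init : (g.cont 0).1 = vinit
  vt_mono : ∀ i j, i ≤ j → j < h.length → vt i ≤ vt j
  vt_le : ∀ i, i < h.length → vt i ≤ g.ver
  pend : ∀ p o i, Pending h p o i ↔ ann p = some o ∧ i = inv p
  link : ∀ p o, ann p = some o → lin (inv p) = g.lin p ∧ vt (inv p) = g.start p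
  comp : ∀ i j r, CompletesAt h i j r →
    ∃ kd k, lin i = some (kd, k) ∧ r = kd.resp (g.cont k) ∧ kd.last k ≤ vt j
  fail : ∀ i j, FailsAt h i j → lin i = none
  sound : ∀ i kd k, lin i = some (kd, k) → ∃ p o, h[i]? = some (.inv p o) ∧
    kd.Matches (g.cont k) o ∧ kd.first (vt i) ≤ k ∧ kd.last k ≤ g.ver
  exists_write : ∀ k, 0 < k → k ≤ g.ver → ∃ i, lin i = some (.write, k)

section

variable {vinit : V} {h : List (Event (Fin N) (Op V) (Resp V))}
  {ann ann' : Fin N → Option (Op V)} {g g' : Ghost N V}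
  {lin : ℕ → Option (Kind × ℕ)} {vt : ℕ → ℕ} {inv : Fin N → ℕ} {p : Fin N} {o : Op V}

theorem hist_init (g : Ghost N V) (h0 : (g.cont 0).1 = vinit) (hv : g.ver = 0) :
    Hist vinit [] (fun _ => none) g (fun _ => none) (fun _ => 0) (fun _ => 0) where
  init := h0
  vt_mono := by simp
  vt_le := by simp
  pend := by simp [Pending]
  link := by simp
  comp := by simp [CompletesAt, EndsWith]
  fail := by simp
  sound := by simp
  exists_write k h1 h2 := by omega

/-- Linearizing a pending operation. -/
theorem Hist.linearize (H : Hist vinit h ann g lin vt inv) {kd : Kind} {k : ℕ}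
    (ha : ann p = some o) (hl : g.lin p = none)
    (hlin : g'.lin = Function.update g.lin p (some (kd, k))) (hstart : g'.start = g.start)
    (hcont : ∀ k, k ≤ g.ver → g'.cont k = g.cont k) (hm : kd.Matches (g'.cont k) o)
    (hfirst : kd.first (g.start p) ≤ k) (hlast : kd.last k ≤ g'.ver) (hver : g.ver ≤ g'.ver)
    (hnew : ∀ j, g.ver < j → j ≤ g'.ver → kd = .write ∧ j = k) :
    Hist vinit h ann g' (Function.update lin (inv p) (some (kd, k))) vt inv := by
  obtain ⟨hl1, hl2⟩ := H.link p o ha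
  have hp : Pending h p o (inv p) := (H.pend _ _ _).2 ⟨ha, rfl⟩
  have hne : ∀ i x, lin i = some x → i ≠ inv p := by
    rintro _ x hx rfl
    simp [hl1, hl] at hx
  have hsome : ∀ i x, lin i = some x → Function.update lin (inv p) (some (kd, k)) i = some x :=
    fun i x hx => by rwa [Function.update_of_ne (hne i x hx)]
  refine ⟨?_, H.vt_mono, fun i hi => (H.vt_le i hi).trans hver, H.pend, ?_, ?_, ?_, ?_, ?_⟩
  · rw [hcont _ (Nat.zero_le _), H.init]
  · intro q o' hq
    rw [hlin, hstart]
    by_cases hqp : q = p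
    · subst hqp; simpa using hl2
    · have : inv q ≠ inv p := by
        intro h1
        have h2 := ((H.pend q o' _).2 ⟨hq, rfl⟩).1
        rw [h1, hp.1] at h2
        simp only [Option.some.injEq, Event.inv.injEq] at h2
        exact hqp h2.1.symm
      rw [Function.update_of_ne this, Function.update_of_ne hqp]
      exact H.link q o' hq
  · intro i j r hc
    obtain ⟨kd', k', h1, h2, h3⟩ := H.comp i j r hc
    obtain ⟨-, -, -, -, -, h4⟩ := H.sound i kd' k' h1
    exact ⟨kd', k', hsome i _ h1, by rwa [hcont _ ((kd'.le_last k').trans h4)], h3⟩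
  · rintro i j ⟨q, hf⟩
    have : i ≠ inv p := by
      rintro rfl
      exact hp.not_endsWith hf
    rw [Function.update_of_ne this]
    exact H.fail i j ⟨q, hf⟩
  · intro i kd' k' hi
    by_cases hip : i = inv p
    · subst hip
      simp only [Function.update_self, Option.some.injEq, Prod.mk.injEq] at hi
      obtain ⟨rfl, rfl⟩ := hi
      exact ⟨p, o, hp.1, hm, by rwa [hl2], hlast⟩
    · rw [Function.update_of_ne hip] at hi
      obtain ⟨q, o', h1, h2, h3, h4⟩ := H.sound i kd' k' hi
      exact ⟨q, o', h1, by rwa [hcont _ ((kd'.le_last k').trans h4)], h3, h4.trans hver⟩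
  · intro j hj hj'
    by_cases hjv : j ≤ g.ver
    · obtain ⟨i, hi⟩ := H.exists_write j hj hjv
      exact ⟨i, hsome i _ hi⟩
    · obtain ⟨rfl, rfl⟩ := hnew j (by omega) hj'
      exact ⟨inv p, by simp⟩

/-- Appending an event to the history. -/
theorem Hist.concat (H : Hist vinit h ann g lin vt inv) {e : Event (Fin N) (Op V) (Resp V)}
    {inv' : Fin N → ℕ} (hver : g'.ver = g.ver) (hcont : g'.cont = g.cont)
    (hpend : ∀ p o i, Pending (h ++ [e]) p o i ↔ ann' p = some o ∧ i = inv' p)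
    (hlink : ∀ p o, ann' p = some o → lin (inv' p) = g'.lin p ∧
      Function.update vt h.length g.ver (inv' p) = g'.start p)
    (hret : ∀ p r, e = .ret p r →
      ∃ kd k, lin (inv p) = some (kd, k) ∧ r = kd.resp (g.cont k))
    (hfail : ∀ p, e = .fail p → lin (inv p) = none) :
    Hist vinit (h ++ [e]) ann' g' lin (Function.update vt h.length g.ver) inv' := by
  have hvt : ∀ i, i < h.length → Function.update vt h.length g.ver i = vt i :=
    fun i hi => Function.update_of_ne hi.ne _ _
  refine ⟨by rw [hcont, H.init], ?_, ?_, hpend, hlink, ?_, ?_, ?_, ?_⟩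
  · intro i j hij hj
    simp only [List.length_append, List.length_cons, List.length_nil] at hj
    rcases hij.eq_or_lt with rfl | hij'
    · exact le_rfl
    rw [hvt i (by omega)]
    by_cases hj' : j = h.length
    · subst hj'
      simpa using H.vt_le i hij'
    · rw [hvt j (by omega)]
      exact H.vt_mono i j hij (by omega)
  · intro i hi
    simp only [List.length_append, List.length_cons, List.length_nil] at hi
    rw [hver]
    by_cases hi' : i = h.length
    · simp [hi']
    · rw [hvt i (by omega)]; exact H.vt_le i (by omega)
  · rintro i j r ⟨p, hc⟩
    rw [hcont]
    rcases hc.of_concat with hc | ⟨rfl, he, q, o, hq, hp⟩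
    · rw [hvt j hc.lt_length]
      exact H.comp i j r ⟨p, hc⟩
    · subst he
      obtain rfl : p = q := by simpa [Event.EndsOp] using hq
      obtain ⟨-, rfl⟩ := (H.pend _ _ _).1 hp
      obtain ⟨kd, k, h1, h2⟩ := hret p r rfl
      obtain ⟨-, -, -, -, -, h3⟩ := H.sound _ _ _ h1
      exact ⟨kd, k, h1, h2, by simpa using h3⟩
  · rintro i j ⟨p, hc⟩
    rcases hc.of_concat with hc | ⟨rfl, he, q, o, hq, hp⟩
    · exact H.fail i j ⟨p, hc⟩
    · subst he
      obtain rfl : p = q := by simpa [Event.EndsOp] using hq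
      obtain ⟨-, rfl⟩ := (H.pend _ _ _).1 hp
      exact hfail p rfl
  · intro i kd k hi
    obtain ⟨p, o, h1, h2, h3, h4⟩ := H.sound i kd k hi
    rw [hcont, hver, hvt i (List.getElem?_eq_some_iff.1 h1).1]
    exact ⟨p, o, getElem?_concat_iff.2 (.inl h1), h2, h3, h4⟩
  · rw [hver]; exact H.exists_write

/-- The end of the pending operation of `p`, with a response or with **fail**. -/
theorem Hist.finish (H : Hist vinit h ann g lin vt inv) (ha : ann p = some o)
    {e : Event (Fin N) (Op V) (Resp V)} (he : ∀ q, e.EndsOp q ↔ q = p)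
    (hret : ∀ q r, e = .ret q r → ∃ kd k, lin (inv p) = some (kd, k) ∧ r = kd.resp (g.cont k))
    (hfail : ∀ q, e = .fail q → lin (inv p) = none) :
    Hist vinit (h ++ [e]) (Function.update ann p none) g lin
      (Function.update vt h.length g.ver) inv := by
  refine H.concat rfl rfl ?_ ?_ ?_ ?_
  · intro q o' i
    have hne : e ≠ .inv q o' := by
      rintro rfl
      exact not_endsOp_inv ((he p).2 rfl)
    rw [pending_concat_iff, H.pend, he]
    by_cases hq : q = p
    · simp [hq, (hq ▸ hne : e ≠ .inv p o')]
    · simp [hq, hne]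
  · intro q o' hq
    have hqp : q ≠ p := by
      rintro rfl
      simp at hq
    rw [Function.update_of_ne hqp] at hq
    have hp := (H.pend q o' _).2 ⟨hq, rfl⟩
    rw [Function.update_of_ne (List.getElem?_eq_some_iff.1 hp.1).1.ne]
    exact H.link q o' hq
  · intro q r hr
    obtain rfl := (he q).1 (.inl ⟨r, hr⟩)
    exact hret q r hr
  · intro q hr
    obtain rfl := (he q).1 (.inr hr)
    exact hfail q hr

theorem Hist.step (H : Hist vinit h ann g lin vt inv)
    {e : Option (Event (Fin N) (Op V) (Resp V))} (hs : GStep ann g e ann' g') :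
    ∃ lin' vt' inv', Hist vinit (h ++ e.toList) ann' g' lin' vt' inv' := by
  cases hs with
  | silent seen =>
    rw [Option.toList_none, List.append_nil]
    exact ⟨lin, vt, inv, H.init, H.vt_mono, H.vt_le, H.pend, H.link, H.comp, H.fail, H.sound,
      H.exists_write⟩
  | read p k ha hl hk hk' =>
    rw [Option.toList_none, List.append_nil]
    exact ⟨_, vt, inv, H.linearize ha hl rfl rfl (fun _ _ => rfl) rfl hk hk' le_rfl
      fun j h1 h2 => absurd h2 (not_le.2 h1)⟩
  | skip p v ha hl hs =>
    rw [Option.toList_none, List.append_nil]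
    exact ⟨_, vt, inv, H.linearize ha hl rfl rfl (fun _ _ => rfl) ⟨v, rfl⟩ le_rfl hs le_rfl
      fun j h1 h2 => absurd h2 (not_le.2 h1)⟩
  | write p v b ha hl hs =>
    rw [Option.toList_none, List.append_nil]
    refine ⟨_, vt, inv, H.linearize ha hl rfl rfl ?_ ?_ ?_ le_rfl (Nat.le_succ _) ?_⟩
    · exact fun k hk => Function.update_of_ne (by omega) _ _
    · simp [Kind.Matches]
    · simpa [Kind.first] using hs
    · exact fun j h1 h2 => ⟨rfl, by simp only at h2; omega⟩
  | invoke p o tog ha =>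
    have hnone : lin h.length = none := by
      by_contra hne
      obtain ⟨⟨kd, k⟩, hx⟩ := Option.ne_none_iff_exists'.1 hne
      obtain ⟨q, o', h1, -⟩ := H.sound _ _ _ hx
      simp at h1
    refine ⟨lin, _, Function.update inv p h.length, H.concat (e := .inv p o) rfl rfl ?_ ?_ ?_ ?_⟩
    · intro q o' i
      rw [pending_concat_iff, H.pend]
      by_cases hq : q = p
      · subst hq; simp [ha, not_endsOp_inv, and_comm]
      · simp [hq, not_endsOp_inv, Ne.symm hq]
    · intro q o' hq
      by_cases hqp : q = p
      · subst hqp; simp [hnone]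
      · rw [Function.update_of_ne hqp] at hq
        have hp := (H.pend q o' _).2 ⟨hq, rfl⟩
        simp only [Function.update_of_ne hqp]
        rw [Function.update_of_ne (List.getElem?_eq_some_iff.1 hp.1).1.ne]
        exact H.link q o' hq
    · simp
    · simp
  | ret p o kd k ha hl =>
    refine ⟨lin, _, inv, H.finish (e := .ret p _) ha ?_ ?_ ?_⟩
    · simp [Event.EndsOp, eq_comm]
    · intro q r hr
      simp only [Event.ret.injEq] at hr
      exact ⟨kd, k, (H.link p o ha).1.trans hl, hr.2.symm⟩
    · simp
  | fail p o ha hl =>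
    refine ⟨lin, _, inv, H.finish (e := .fail p) ha ?_ ?_ ?_⟩
    · simp [Event.EndsOp, eq_comm]
    · simp
    · exact fun q _ => (H.link p o ha).1.trans hl
  | crash =>
    refine ⟨lin, _, inv, H.concat (e := .crash) rfl rfl ?_ ?_ ?_ ?_⟩
    · intro q o' i
      rw [pending_concat_iff, H.pend]
      simp [not_endsOp_crash]
    · intro q o' hq
      have hp := (H.pend q o' _).2 ⟨hq, rfl⟩
      rw [Function.update_of_ne (List.getElem?_eq_some_iff.1 hp.1).1.ne]
      exact H.link q o' hq
    · simp
    · simp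

/-- The invariants hold in every execution. -/
theorem Exec.invariant {tr : List (Action N V)} {c : Config N V}
    (hE : Exec (DetectableRW.init N vinit) tr c) :
    ∃ g lin vt inv, Inv g c ∧ Hist vinit (history tr) c.mem.annOp g lin vt inv := by
  induction hE with
  | nil => exact ⟨_, _, _, _, inv_init N vinit, hist_init _ rfl rfl⟩
  | snoc hE hs ih =>
    obtain ⟨g, lin, vt, inv, hI, H⟩ := ih
    obtain ⟨g', hg, hI'⟩ := hI.step hs
    obtain ⟨lin', vt', inv', H'⟩ := H.step hg
    refine ⟨g', lin', vt', inv', hI', ?_⟩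
    convert H' using 1
    rw [history, List.filterMap_append]
    congr 1

end

section

variable {vinit : V} {h : List (Event (Fin N) (Op V) (Resp V))}
  {ann : Fin N → Option (Op V)} {g : Ghost N V}
  {lin : ℕ → Option (Kind × ℕ)} {vt : ℕ → ℕ} {inv : Fin N → ℕ}

/-! ### The sequential order -/

open Classical in
/-- The operations among the first `n` positions that are linearized in the way `kd` at version `k`,
in the order of their invocations. -/
noncomputable def cell (lin : ℕ → Option (Kind × ℕ)) (n k : ℕ) (kd : Kind) : List ℕ :=
  (List.range n).filter fun i => decide (lin i = some (kd, k))

/-- The operations linearized at version `k`: the write that creates the version, the reads, and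
the writes that are overwritten by the next version. -/
noncomputable def block (lin : ℕ → Option (Kind × ℕ)) (n k : ℕ) : List ℕ :=
  [Kind.write, Kind.read, Kind.skip].flatMap (cell lin n k)

/-- The operations linearized at the versions up to `v`. -/
noncomputable def order (lin : ℕ → Option (Kind × ℕ)) (n v : ℕ) : List ℕ :=
  (List.range (v + 1)).flatMap (block lin n)

theorem mem_cell {n k i : ℕ} {kd : Kind} :
    i ∈ cell lin n k kd ↔ i < n ∧ lin i = some (kd, k) := by
  simp [cell]

theorem mem_block {n k i : ℕ} :
    i ∈ block lin n k ↔ i < n ∧ ∃ kd, lin i = some (kd, k) := by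
  simp only [block, List.mem_flatMap, mem_cell]
  constructor
  · rintro ⟨kd, -, h1, h2⟩
    exact ⟨h1, kd, h2⟩
  · rintro ⟨h1, kd, h2⟩
    exact ⟨kd, by cases kd <;> simp, h1, h2⟩

theorem mem_order {n v i : ℕ} :
    i ∈ order lin n v ↔ i < n ∧ ∃ kd k, k ≤ v ∧ lin i = some (kd, k) := by
  simp only [order, List.mem_flatMap, mem_block, List.mem_range, Nat.lt_succ_iff]
  grind

/-- The position of the operations of each kind within their block. -/
def Kind.rank : Kind → ℕ
  | .write => 0
  | .read => 1
  | .skip => 2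

/-- The strict order on linearized operations according to which they are listed. -/
def Before (lin : ℕ → Option (Kind × ℕ)) (i i' : ℕ) : Prop :=
  ∃ kd k kd' k', lin i = some (kd, k) ∧ lin i' = some (kd', k') ∧
    (k < k' ∨ k = k' ∧ (kd.rank < kd'.rank ∨ kd = kd' ∧ i < i'))

theorem Before.ne {i i' : ℕ} (H : Before lin i i') : i ≠ i' := by
  rintro rfl
  obtain ⟨kd, k, kd', k', h1, h2, h3⟩ := H
  rw [h1] at h2
  simp only [Option.some.injEq, Prod.mk.injEq] at h2
  obtain ⟨rfl, rfl⟩ := h2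
  omega

theorem pairwise_order (n v : ℕ) : (order lin n v).Pairwise (Before lin) := by
  refine List.pairwise_flatMap.2 ⟨fun k _ => List.pairwise_flatMap.2 ⟨fun kd _ => ?_, ?_⟩, ?_⟩
  · refine (List.pairwise_lt_range.filter _).imp_of_mem ?_
    intro i i' hi hi' hlt
    exact ⟨kd, k, kd, k, (mem_cell.1 hi).2, (mem_cell.1 hi').2, .inr ⟨rfl, .inr ⟨rfl, hlt⟩⟩⟩
  · have : [Kind.write, Kind.read, Kind.skip].Pairwise (fun a b => a.rank < b.rank) := by
      simp [Kind.rank]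
    refine this.imp fun {a b} hab i hi i' hi' => ?_
    exact ⟨a, k, b, k, (mem_cell.1 hi).2, (mem_cell.1 hi').2, .inr ⟨rfl, .inl hab⟩⟩
  · refine List.pairwise_lt_range.imp fun {k k'} hkk i hi i' hi' => ?_
    obtain ⟨-, kd, h1⟩ := mem_block.1 hi
    obtain ⟨-, kd', h2⟩ := mem_block.1 hi'
    exact ⟨kd, k, kd', k', h1, h2, .inl hkk⟩

/-- The listing is compatible with the real-time order. -/
theorem Hist.not_completes_before (H : Hist vinit h ann g lin vt inv) {i i' j : ℕ} {r : Resp V}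
    (hb : Before lin i i') (hc : CompletesAt h i' j r) : ¬ j < i := by
  intro hji
  obtain ⟨kd, k, kd', k', h1, h2, h3⟩ := hb
  obtain ⟨kd₁, k₁, h4, -, h5⟩ := H.comp i' j r hc
  rw [h2] at h4
  simp only [Option.some.injEq, Prod.mk.injEq] at h4
  obtain ⟨rfl, rfl⟩ := h4
  obtain ⟨p, o, h6, -, h7, -⟩ := H.sound i kd k h1
  have h8 := H.vt_mono j i hji.le (List.getElem?_eq_some_iff.1 h6).1
  obtain ⟨q, hc⟩ := hc
  have h9 := hc.lt
  have h10 := kd.le_first (vt i)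
  have h11 := kd'.le_last k'
  rcases h3 with h3 | ⟨rfl, h3 | ⟨-, h3⟩⟩
  · omega
  · cases kd <;> cases kd' <;> simp only [Kind.rank, Kind.first, Kind.last] at * <;> omega
  · omega

/-- The operation invoked at position `i`; `read` if there is none. -/
def opAt (h : List (Event (Fin N) (Op V) (Resp V))) (i : ℕ) : Op V :=
  match h[i]? with
  | some (.inv _ o) => o
  | _ => .read

/-- The response of the operation `i`; `ack` if it has not been linearized. -/
def respAt (g : Ghost N V) (lin : ℕ → Option (Kind × ℕ)) (i : ℕ) : Resp V :=
  match lin i with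
  | some (kd, k) => kd.resp (g.cont k)
  | none => .ack

theorem Hist.opAt_matches (H : Hist vinit h ann g lin vt inv) {i k : ℕ} {kd : Kind}
    (hi : lin i = some (kd, k)) : kd.Matches (g.cont k) (opAt h i) := by
  obtain ⟨p, o, h1, h2, -⟩ := H.sound i kd k hi
  simpa [opAt, h1] using h2

theorem respAt_eq {i k : ℕ} {kd : Kind} (hi : lin i = some (kd, k)) :
    respAt g lin i = kd.resp (g.cont k) := by
  simp [respAt, hi]

theorem legal_writes {s : V} {l : List (Op V × Resp V)}
    (hl : ∀ x ∈ l, ∃ v, x = (.write v, .ack)) : Legal spec s l := by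
  induction l generalizing s with
  | nil => trivial
  | cons x l ih =>
    obtain ⟨v, rfl⟩ := hl x List.mem_cons_self
    exact ⟨rfl, ih fun y hy => hl y (List.mem_cons_of_mem _ hy)⟩

theorem foldl_writes {s w : V} {l : List (Op V × Resp V)}
    (hl : ∀ x ∈ l, x = (.write w, .ack)) (hs : l ≠ [] ∨ s = w) :
    l.foldl (fun s x => (spec s x.1).1) s = w := by
  induction l generalizing s with
  | nil => simpa using hs
  | cons x l ih =>
    obtain rfl := hl x List.mem_cons_self
    exact ih (fun y hy => hl y (List.mem_cons_of_mem _ hy)) (.inr rfl)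

theorem legal_reads {s : V} {l : List (Op V × Resp V)}
    (hl : ∀ x ∈ l, x = (.read, .value s)) :
    Legal spec s l ∧ l.foldl (fun s x => (spec s x.1).1) s = s := by
  induction l with
  | nil => exact ⟨trivial, rfl⟩
  | cons x l ih =>
    obtain rfl := hl x List.mem_cons_self
    obtain ⟨h1, h2⟩ := ih fun y hy => hl y (List.mem_cons_of_mem _ hy)
    exact ⟨⟨rfl, h1⟩, h2⟩

/-- A block is legal from every state, since it starts with a write; for the first block, the
initial value takes the place of this write. -/
theorem Hist.legal_block (H : Hist vinit h ann g lin vt inv) {s : V} {k : ℕ} (hk : k ≤ g.ver)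
    (hs : k = 0 → s = vinit) :
    Legal spec s ((block lin h.length k).map fun i => (opAt h i, respAt g lin i)) := by
  have hw : ∀ x ∈ (cell lin h.length k .write).map (fun i => (opAt h i, respAt g lin i)),
      x = (.write (g.cont k).1, .ack) := by
    simp only [List.mem_map, mem_cell]
    rintro _ ⟨i, ⟨-, hi⟩, rfl⟩
    rw [respAt_eq hi, H.opAt_matches hi]
    rfl
  have hr : ∀ x ∈ (cell lin h.length k .read).map (fun i => (opAt h i, respAt g lin i)),
      x = (.read, .value (g.cont k).1) := by
    simp only [List.mem_map, mem_cell]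
    rintro _ ⟨i, ⟨-, hi⟩, rfl⟩
    rw [respAt_eq hi, H.opAt_matches hi]
    rfl
  have hsk : ∀ x ∈ (cell lin h.length k .skip).map (fun i => (opAt h i, respAt g lin i)),
      ∃ v, x = (.write v, .ack) := by
    simp only [List.mem_map, mem_cell]
    rintro _ ⟨i, ⟨-, hi⟩, rfl⟩
    obtain ⟨v, hv⟩ := H.opAt_matches hi
    exact ⟨v, by rw [respAt_eq hi, hv]; rfl⟩
  have hfold := foldl_writes (s := s) hw <| by
    rcases Nat.eq_zero_or_pos k with rfl | hk0
    · exact .inr ((hs rfl).trans H.init.symm)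
    · obtain ⟨i, hi⟩ := H.exists_write k hk0 hk
      obtain ⟨p, o, h1, -⟩ := H.sound _ _ _ hi
      left
      simpa using List.ne_nil_of_mem (mem_cell.2 ⟨(List.getElem?_eq_some_iff.1 h1).1, hi⟩)
  obtain ⟨hr1, hr2⟩ := legal_reads hr
  simp only [block, List.flatMap_cons, List.flatMap_nil, List.append_nil, List.map_append]
  rw [legal_append, legal_append, hfold, hr2]
  exact ⟨legal_writes fun x hx => ⟨_, hw x hx⟩, hr1, legal_writes hsk⟩

theorem Hist.legal_order (H : Hist vinit h ann g lin vt inv) :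
    Legal spec vinit ((order lin h.length g.ver).map fun i => (opAt h i, respAt g lin i)) := by
  have key : ∀ ks : List ℕ, (∀ k ∈ ks, 0 < k ∧ k ≤ g.ver) → ∀ s,
      Legal spec s ((ks.flatMap (block lin h.length)).map
        fun i => (opAt h i, respAt g lin i)) := by
    intro ks
    induction ks with
    | nil => exact fun _ _ => trivial
    | cons k ks ih =>
      intro hks s
      obtain ⟨h1, h2⟩ := hks k List.mem_cons_self
      rw [List.flatMap_cons, List.map_append, legal_append]
      exact ⟨H.legal_block h2 (by omega), ih (fun j hj => hks j (List.mem_cons_of_mem _ hj)) _⟩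
  rw [order, List.range_succ_eq_map, List.flatMap_cons, List.map_append, legal_append]
  refine ⟨H.legal_block (Nat.zero_le _) fun _ => rfl, key _ ?_ _⟩
  simp only [List.mem_map, List.mem_range]
  rintro _ ⟨k, hk, rfl⟩
  omega

theorem Hist.exists_linearization (H : Hist vinit h ann g lin vt inv) :
    ∃ S : List (ℕ × Op V × Resp V),
      IsDurableLinearization spec vinit h S ∧ IsDetectable h S := by
  have hmem : ∀ i kd k, lin i = some (kd, k) → i ∈ order lin h.length g.ver := by
    intro i kd k hi
    obtain ⟨p, o, h1, -, -, h2⟩ := H.sound i kd k hi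
    exact mem_order.2 ⟨(List.getElem?_eq_some_iff.1 h1).1, kd, k, (kd.le_last k).trans h2, hi⟩
  have hcomp : ∀ i j r, CompletesAt h i j r →
      ∃ o, (i, o, r) ∈ (order lin h.length g.ver).map fun i => (i, opAt h i, respAt g lin i) := by
    intro i j r hc
    obtain ⟨kd, k, h1, h2, -⟩ := H.comp i j r hc
    exact ⟨opAt h i, List.mem_map.2 ⟨i, hmem i kd k h1, by rw [respAt_eq h1, h2]⟩⟩
  refine ⟨(order lin h.length g.ver).map fun i => (i, opAt h i, respAt g lin i),
    ⟨?_, ?_, hcomp, ?_, ?_⟩, ⟨?_, hcomp⟩⟩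
  · simp only [List.mem_map, mem_order]
    rintro _ ⟨i, ⟨-, kd, k, -, hi⟩, rfl⟩
    obtain ⟨p, o, h1, -⟩ := H.sound i kd k hi
    exact ⟨p, by simp [opAt, h1]⟩
  · rw [List.map_map]
    exact (List.pairwise_map.2 ((pairwise_order _ _).imp fun hb => hb.ne))
  · exact List.pairwise_map.2 ((pairwise_order _ _).imp
      fun hb j r hc => H.not_completes_before hb hc)
  · rw [List.map_map]
    exact H.legal_order
  · simp only [List.mem_map, mem_order]
    rintro i j hf _ ⟨i', ⟨-, kd, k, -, hi⟩, rfl⟩ rfl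
    rw [H.fail _ j hf] at hi
    simp at hi

end

/-! ### Wait-freedom -/

/-- A bound on the number of instructions that precede the `return` instruction. -/
def Local.rank : Local N V → ℕ
  | .idle | .retResp _ | .retFail => 0
  | .setAck => 1
  | .flipT _ => 2
  | .setBits _ i => 3 + (N - i)
  | .setCP2 _ => N + 4
  | .wWriteR _ _ => N + 5
  | .wSetCP1 _ _ => N + 6
  | .wRereadR _ _ _ => N + 7
  | .wPersist _ _ _ => N + 8
  | .wReadT _ _ => N + 9
  | .wResetBit _ _ => N + 10
  | .wReadR _ => N + 11
  | .recCheckBit _ _ => N + 5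
  | .recCheckR _ _ => N + 6
  | .recCheckCP1 _ => N + 7
  | .recCheckCP0 _ => N + 8
  | .recCheckResp _ => N + 9
  | .recReadRD => N + 10
  | .rPersist _ => 1
  | .rReadR => 2
  | .rRecCheckResp => 3

theorem Local.rank_le (l : Local N V) : l.rank ≤ N + 11 := by
  cases l <;> simp only [rank] <;> omega

theorem Instr.rank_lt {p : Fin N} {m m' : Memory N V} {l l' : Local N V}
    (h : Instr p m l m' l') : l'.rank < l.rank := by
  cases h <;> simp only [Local.rank] <;> omega

theorem Instr.ne_idle {p : Fin N} {m m' : Memory N V} {l l' : Local N V}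
    (h : Instr p m l m' l') : l' ≠ .idle := by
  cases h <;> simp

/-- A process that is not idle can execute an instruction. The invariant is needed only to exclude
local states that do not occur: a loop index beyond `N`, and an empty `RD_p` when `Ann_p.CP ≠ 0`. -/
theorem Inv.exists_instr {g : Ghost N V} {c : Config N V} (hI : Inv g c) {p : Fin N}
    (hl : c.loc p ≠ .idle) : ∃ a c', a.IsInstrOf p ∧ Step c a c' := by
  suffices h : (∃ r, c.loc p = .retResp r) ∨ c.loc p = .retFail ∨
      ∃ m' l', Instr p c.mem (c.loc p) m' l' by
    rcases h with ⟨r, h⟩ | h | ⟨m', l', h⟩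
    · exact ⟨_, _, .inr (.inl ⟨r, rfl⟩), .ret c p r h⟩
    · exact ⟨_, _, .inr (.inr rfl), .fail c p h⟩
    · exact ⟨_, _, .inl rfl, .step c p m' l' h⟩
  have hP := hI.proc p
  cases hlp : c.loc p with
  | idle => exact absurd hlp hl
  | wReadR val => exact .inr (.inr ⟨_, _, .wReadR ..⟩)
  | wResetBit val t => exact .inr (.inr ⟨_, _, .wResetBit ..⟩)
  | wReadT val t => exact .inr (.inr ⟨_, _, .wReadT ..⟩)
  | wPersist val t b => exact .inr (.inr ⟨_, _, .wPersist ..⟩)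
  | wRereadR val t b =>
    by_cases h : c.mem.R = t
    · exact .inr (.inr ⟨_, _, .wRereadR_eq _ _ _ _ h⟩)
    · exact .inr (.inr ⟨_, _, .wRereadR_ne _ _ _ _ h⟩)
  | wSetCP1 val b => exact .inr (.inr ⟨_, _, .wSetCP1 ..⟩)
  | wWriteR val b => exact .inr (.inr ⟨_, _, .wWriteR ..⟩)
  | setCP2 b => exact .inr (.inr ⟨_, _, .setCP2 ..⟩)
  | setBits b i =>
    obtain ⟨w, -, -, h3⟩ := hP.write (by simp [hlp, Local.IsWrite])
    simp only [hlp, WriteLoc] at h3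
    rcases h3.2.1.eq_or_lt with rfl | h
    · exact .inr (.inr ⟨_, _, .setBits_end ..⟩)
    · exact .inr (.inr ⟨_, _, .setBits _ _ ⟨i, h⟩⟩)
  | flipT b => exact .inr (.inr ⟨_, _, .flipT ..⟩)
  | setAck => exact .inr (.inr ⟨_, _, .setAck ..⟩)
  | recReadRD => exact .inr (.inr ⟨_, _, .recReadRD ..⟩)
  | recCheckResp rd =>
    by_cases h : c.mem.annResp p = none
    · exact .inr (.inr ⟨_, _, .recCheckResp_bot _ _ h⟩)
    · exact .inr (.inr ⟨_, _, .recCheckResp_set _ _ h⟩)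
  | recCheckCP0 rd =>
    by_cases h : c.mem.annCP p = 0
    · exact .inr (.inr ⟨_, _, .recCheckCP0_eq _ _ h⟩)
    · exact .inr (.inr ⟨_, _, .recCheckCP0_ne _ _ h⟩)
  | recCheckCP1 rd =>
    obtain ⟨w, -, h2, h3⟩ := hP.write (by simp [hlp, Local.IsWrite])
    simp only [hlp, WriteLoc] at h3
    have hrd : ∃ b t, rd = some (b, t) := by
      rcases h2 with ⟨h2, -⟩ | ⟨-, -, -, -, t, h2, -⟩ | ⟨-, -, -, ⟨t, h2⟩, -⟩
      · exact absurd h2 h3.2.2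
      · exact ⟨_, t, h3.1.trans h2⟩
      · exact ⟨_, t, h3.1.trans h2⟩
    obtain ⟨b, t, rfl⟩ := hrd
    by_cases h : c.mem.annCP p = 1
    · exact .inr (.inr ⟨_, _, .recCheckCP1_eq _ _ _ h⟩)
    · exact .inr (.inr ⟨_, _, .recCheckCP1_ne _ _ _ h⟩)
  | recCheckR b t =>
    by_cases h : c.mem.R = t
    · exact .inr (.inr ⟨_, _, .recCheckR_eq _ _ _ h⟩)
    · exact .inr (.inr ⟨_, _, .recCheckR_ne _ _ _ h⟩)
  | recCheckBit b t =>
    obtain ⟨v, j, d⟩ := t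
    cases h : c.mem.A p j (!d) with
    | false => exact .inr (.inr ⟨_, _, .recCheckBit_zero _ _ _ _ _ h⟩)
    | true => exact .inr (.inr ⟨_, _, .recCheckBit_one _ _ _ _ _ h⟩)
  | rReadR => exact .inr (.inr ⟨_, _, .rReadR ..⟩)
  | rPersist v => exact .inr (.inr ⟨_, _, .rPersist ..⟩)
  | rRecCheckResp =>
    cases h : c.mem.annResp p with
    | none => exact .inr (.inr ⟨_, _, .rRecCheckResp_bot _ h⟩)
    | some r => exact .inr (.inr ⟨_, _, .rRecCheckResp_set _ r h⟩)
  | retResp r => exact .inl ⟨r, rfl⟩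
  | retFail => exact .inr (.inl rfl)

theorem Exec.trans {c c' c'' : Config N V} {tr tr' : List (Action N V)} (h : Exec c tr c')
    (h' : Exec c' tr' c'') : Exec c (tr ++ tr') c'' := by
  induction h' with
  | nil => rwa [List.append_nil]
  | snoc _ hs ih => rw [← List.append_assoc]; exact .snoc ih hs

theorem Exec.numInstr_add_rank_le {p : Fin N} {c c' : Config N V} {tr : List (Action N V)}
    (h : Exec c tr c') (hl : c.loc p ≠ .idle)
    (htr : ∀ a ∈ tr, a ≠ .crash ∧ ¬ a.IsReturnOf p) :
    c'.loc p ≠ .idle ∧ numInstr p tr + (c'.loc p).rank ≤ (c.loc p).rank := by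
  induction h with
  | nil => exact ⟨hl, by simp [numInstr]⟩
  | @snoc c₁ c₂ tr a _ hs ih =>
    obtain ⟨h1, h2⟩ := ih fun b hb => htr b (List.mem_append_left _ hb)
    obtain ⟨h3, h4⟩ := htr a (by simp)
    have hnum : ¬ a.IsInstrOf p → numInstr p (tr ++ [a]) = numInstr p tr := by
      intro h
      simp [numInstr, List.countP_append, h]
    have hnum' : numInstr p (tr ++ [a]) ≤ numInstr p tr + 1 := by
      simp only [numInstr, List.countP_append, add_le_add_iff_left]
      exact List.countP_le_length
    -- actions of other processes do not affect the local state of `p`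
    have hother : ∀ q l, q ≠ p → ¬ a.IsInstrOf p →
        Function.update c₁.loc q l p ≠ .idle ∧
          numInstr p (tr ++ [a]) + (Function.update c₁.loc q l p).rank ≤ (c.loc p).rank := by
      intro q l hq ha
      rw [hnum ha, Function.update_of_ne (Ne.symm hq)]
      exact ⟨h1, h2⟩
    cases hs with
    | invoke q o hq =>
      refine hother q _ ?_ (by simp [Action.IsInstrOf, Action.IsReturnOf])
      rintro rfl
      exact h1 hq
    | recover q o hq =>
      refine hother q _ ?_ (by simp [Action.IsInstrOf, Action.IsReturnOf])
      rintro rfl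
      exact h1 hq
    | step q m' l' hi =>
      by_cases hq : q = p
      · subst hq
        have := hi.rank_lt
        simp only [Function.update_self]
        exact ⟨hi.ne_idle, by omega⟩
      · exact hother q _ hq (by simp [Action.IsInstrOf, Action.IsReturnOf, hq])
    | ret q r hq =>
      have hqp : q ≠ p := by
        rintro rfl
        exact h4 (.inl ⟨r, rfl⟩)
      exact hother q _ hqp (by simp [Action.IsInstrOf, Action.IsReturnOf, hqp])
    | fail q hq =>
      have hqp : q ≠ p := by
        rintro rfl
        exact h4 (.inr rfl)
      exact hother q _ hqp (by simp [Action.IsInstrOf, Action.IsReturnOf, hqp])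
    | crash => exact absurd rfl h3

theorem waitFree (N : ℕ) (vinit : V) : WaitFree N vinit := by
  refine ⟨⟨N + 11, ?_⟩, ?_⟩
  · rintro c p ⟨tr₀, h₀⟩ hl tr c' h htr
    obtain ⟨h1, h2⟩ := h.numInstr_add_rank_le hl htr
    obtain ⟨g, -, -, -, hI, -⟩ := (h₀.trans h).invariant
    exact ⟨(Nat.le_add_right _ _).trans (h2.trans (c.loc p).rank_le), hI.exists_instr h1⟩
  · intro c p _ hl ha
    obtain ⟨o, ho⟩ := Option.ne_none_iff_exists'.1 ha
    exact ⟨_, .recover c p o hl ho⟩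

end DetectableRW

theorem mainTheorem3 {V : Type*} (N : ℕ) (vinit : V) :
    DetectableRW.WaitFree N vinit ∧
    ∀ (tr : List (DetectableRW.Action N V)) (c : DetectableRW.Config N V),
      DetectableRW.Exec (DetectableRW.init N vinit) tr c →
        ∃ S : List (ℕ × DetectableRW.Op V × DetectableRW.Resp V),
          CrashRecovery.IsDurableLinearization DetectableRW.spec vinit
            (DetectableRW.history tr) S ∧
          CrashRecovery.IsDetectable (DetectableRW.history tr) S := by
  refine ⟨DetectableRW.waitFree N vinit, fun tr c hE => ?_⟩
  obtain ⟨g, lin, vt, inv, -, H⟩ := hE.invariant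
  exact H.exists_linearization
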